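/- Let $\mathbf D$ be an infinite set of domain values and $\mathbf X$ a set of variables, both written as bit strings by fixed injective encodings. A relational schema is a finite list of relation names $R$, each with a nonempty finite set of attributes; a database over it assigns to every $R$ a finite set of tuples over $\mathbf D$. A (tuple-level) gWSD over a schema is a pair $\mathcal W=(\{C_1,\dots,C_m\},\phi)$. Here $\phi$ is a finite conjunction of possibly negated equalities between elements of $\mathbf D\cup\mathbf X$. The $C_i$ (components) are finite, possibly empty, sets of rows with entries in $\mathbf D\cup\mathbf X\cup\{\bot\}$; their column sets are nonempty and pairwise disjoint, and consist of columns $R.d.A$ with $R$ a relation name, $d$ a tuple identifier and $A$ an attribute of $R$, where, together with one column $R.d.A$, the component contains $R.d.B$ for every attribute $B$ of $R$. A row $w\in C_1\times\dots\times C_m$ and a valuation $\nu:\mathbf X\to\mathbf D$ satisfying $\phi$ yield the database in which $R$ consists of the tuples $\nu(w(R.d))$, for all tuple identifiers $R.d$ of $\mathcal W$ such that no field of $w(R.d)$ is $\bot$. The set $\mathit{rep}(\mathcal W)$ of possible worlds consists of all databases obtained in this way. **Theorem.** Instance certainty is in PTIME for gWSDs: there are a Turing machine and a polynomial $p$ such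 that, given (a string encoding of) a schema, a gWSD $\mathcal W$ and a database $I$ over that schema, the machine decides in at most $p(n)$ steps, $n$ being the length of the input string, whether every world $\mathcal A\in\mathit{rep}(\mathcal W)$ is equal to $I$. -/

import Mathlib

namespace WSD

/-! ### Relational schemas and databases -/

/-- A relational schema `(R₁[U₁], …, Rₖ[Uₖ])`.  Relation names are the positions in the list; the
attribute set of `R`, which is nonempty, is `Fin (arity of R)`. -/
structure Schema where
  arities : List ℕ
  arities_pos : ∀ k ∈ arities, 0 < k

/-- The relation names of a schema. -/
abbrev Schema.Rel (S : Schema) : Type := Fin S.arities.length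

/-- The arity of a relation. -/
def Schema.arity (S : Schema) (R : S.Rel) : ℕ := S.arities.get R

/-- A tuple over the relation schema `R[U]` with entries in `V`. -/
abbrev Tuple (S : Schema) (R : S.Rel) (V : Type) : Type := Fin (S.arity R) → V

/-- A database over the schema: one relation (set of tuples of domain values) for every relation
name. (All databases that occur below, worlds and input instances, have finite relations.) -/
abbrev Database (S : Schema) (D : Type) : Type := (R : S.Rel) → Set (Tuple S R D)

/-! ### Terms, conditions, g-multitables -/

/-- A domain value or a variable, i.e. an element of `𝐃 ∪ 𝐗`. -/
inductive Term (D X : Type) where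
  | const (d : D)
  | var (x : X)

/-- Extension of a valuation to `𝐃 ∪ 𝐗`, the identity on domain values. -/
def Term.eval {D X : Type} (ν : X → D) : Term D X → D
  | .const d => d
  | .var x => ν x

/-- A possibly negated equality: `lhs = rhs` if `positive` is true, `lhs ≠ rhs` otherwise. -/
structure Literal (D X : Type) where
  positive : Bool
  lhs : Term D X
  rhs : Term D X

/-- Truth of a literal under a valuation. -/
def Literal.Holds {D X : Type} (ν : X → D) (l : Literal D X) : Prop :=
  if l.positive = true then l.lhs.eval ν = l.rhs.eval ν else l.lhs.eval ν ≠ l.rhs.eval ν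

/-- A conjunction of possibly negated equalities (the empty conjunction is "true"). -/
abbrev Condition (D X : Type) : Type := List (Literal D X)

/-- Truth of a condition under a valuation. -/
def Condition.Holds {D X : Type} (ν : X → D) (φ : Condition D X) : Prop :=
  ∀ l ∈ φ, l.Holds ν

/-- A g-multitable: one table over `𝐃 ∪ 𝐗` for every relation name, and a global condition. -/
structure GMultitable (S : Schema) (D X : Type) where
  table : (R : S.Rel) → Set (Tuple S R (Term D X))
  cond : Condition D X

/-- The database `ν(𝒯)`. -/
def GMultitable.apply {S : Schema} {D X : Type} (T : GMultitable S D X) (ν : X → D) :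
    Database S D :=
  fun R => (fun t : Tuple S R (Term D X) => fun j => (t j).eval ν) '' T.table R

/-- The representation of a g-multitable: all `ν(𝒯)` for the satisfactions `ν`. -/
def GMultitable.rep {S : Schema} {D X : Type} (T : GMultitable S D X) : Set (Database S D) :=
  {A | ∃ ν : X → D, T.cond.Holds ν ∧ A = T.apply ν}

/-! ### Tabset tables and their (tuple-level) decompositions -/

/-- A field of a tabset table: a domain value, a variable, or `⊥` (which is `none`). -/
abbrev Field (D X : Type) : Type := Option (Term D X)

/-- A tuple identifier `R.d`; it stands for the group of columns `R.d.A`, `A` an attribute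
of `R`. -/
structure TupleId (S : Schema) where
  rel : S.Rel
  num : ℕ

/-- A row over the columns `R.d.A` with `R.d` in the list `L` and `A` an attribute of `R`. -/
abbrev Row (S : Schema) (D X : Type) (L : List (TupleId S)) : Type :=
  (s : {s : TupleId S // s ∈ L}) → Tuple S s.1.rel (Field D X)

/-- The g-multitable `inline⁻¹(w)` with the global condition `φ`: the tuple with identifier `R.d`
is dropped if one of its fields is `⊥`. -/
def uninline {S : Schema} {D X : Type} {L : List (TupleId S)} (w : Row S D X L)
    (φ : Condition D X) : GMultitable S D X where
  table R := {t | ∃ (d : ℕ) (h : TupleId.mk R d ∈ L), ∀ j, w ⟨⟨R, d⟩, h⟩ j = some (t j)}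
  cond := φ

/-- The representation of the gTST `(W, φ)`, where `W` is a table over the columns given
by `L`. -/
def repGTST {S : Schema} {D X : Type} {L : List (TupleId S)} (W : Set (Row S D X L))
    (φ : Condition D X) : Set (Database S D) :=
  ⋃ w ∈ W, (uninline w φ).rep

/-- A component of a tuple-level decomposition. Its column set is nonempty and contains, with one
column `R.d.A`, all columns `R.d.B`, so it is given by a list of tuple identifiers. Its finite
set of rows is given by a list; order and repetitions are irrelevant. -/
structure Component (S : Schema) (D X : Type) where
  ids : List (TupleId S)
  ids_ne_nil : ids ≠ []
  rows : List (Row S D X ids)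

/-- A tuple-level gWSD `({C₁, …, Cₘ}, φ)`: components with pairwise disjoint sets of columns, and
a global condition. -/
structure GWSD (S : Schema) (D X : Type) where
  comps : List (Component S D X)
  nodup : (comps.flatMap Component.ids).Nodup
  cond : Condition D X

/-- All tuple identifiers of a gWSD. -/
def GWSD.ids {S : Schema} {D X : Type} (W : GWSD S D X) : List (TupleId S) :=
  W.comps.flatMap Component.ids

/-- The relational product `C₁ × ⋯ × Cₘ` of the components. -/
def GWSD.product {S : Schema} {D X : Type} (W : GWSD S D X) : Set (Row S D X W.ids) :=
  {w | ∀ (C : Component S D X) (hC : C ∈ W.comps),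
    (fun s : {s : TupleId S // s ∈ C.ids} =>
      w ⟨s.1, List.mem_flatMap.2 ⟨C, hC, s.2⟩⟩) ∈ C.rows}

/-- The set of possible worlds of a gWSD. -/
def GWSD.rep {S : Schema} {D X : Type} (W : GWSD S D X) : Set (Database S D) :=
  repGTST W.product W.cond

/-! ### Instance certainty -/

/-- An input instance: a database given by the list of its facts `R(t)`. -/
abbrev Instance (S : Schema) (D : Type) : Type := List ((R : S.Rel) × Tuple S R D)

/-- The database denoted by an input instance. -/
def Instance.toDatabase {S : Schema} {D : Type} (I : Instance S D) : Database S D :=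
  fun R => {t | (⟨R, t⟩ : (R : S.Rel) × Tuple S R D) ∈ I}

/-- An input of the instance certainty problem: a schema, a gWSD and an instance over it. -/
structure Input (D X : Type) where
  schema : Schema
  wsd : GWSD schema D X
  inst : Instance schema D

/-- Instance certainty: every world of the gWSD equals the given instance. -/
def InstanceCertain {D X : Type} (p : Input D X) : Prop :=
  ∀ A ∈ p.wsd.rep, p.inst.toDatabase = A

/-! ### Inputs as strings

Domain values and variables are written as bit strings by means of `eD` and `eX`; numbers are
written in binary. -/

/-- The finite input alphabet. -/
inductive Sym where
  | bit (b : Bool)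
  | eow | const | var | bot | eq | ne | arity | comp | row | tup | lit | close
  deriving DecidableEq, Fintype

/-- A bit string, followed by an end marker. -/
def encBits (w : List Bool) : List Sym := w.map Sym.bit ++ [Sym.eow]

/-- A number in binary. -/
def encNat (n : ℕ) : List Sym := encBits (Computability.encodeNat n)

/-- A list: every entry is preceded by the symbol `o`, the end is marked by `close`. -/
def encList {α : Type} (o : Sym) (enc : α → List Sym) (l : List α) : List Sym :=
  l.flatMap (fun a => o :: enc a) ++ [Sym.close]

/-- A domain value or variable. -/
def encTerm {D X : Type} (eD : D ↪ List Bool) (eX : X ↪ List Bool) : Term D X → List Sym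
  | .const d => Sym.const :: encBits (eD d)
  | .var x => Sym.var :: encBits (eX x)

/-- A field. -/
def encField {D X : Type} (eD : D ↪ List Bool) (eX : X ↪ List Bool) : Field D X → List Sym
  | none => [Sym.bot]
  | some t => encTerm eD eX t

/-- A possibly negated equality. -/
def encLiteral {D X : Type} (eD : D ↪ List Bool) (eX : X ↪ List Bool) (l : Literal D X) :
    List Sym :=
  (if l.positive = true then Sym.eq else Sym.ne) :: (encTerm eD eX l.lhs ++ encTerm eD eX l.rhs)

/-- A tuple identifier `R.d`. -/
def encId {S : Schema} (s : TupleId S) : List Sym := encNat s.num ++ encNat s.rel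

/-- The entries of a tuple, one after the other. -/
def encTuple {V : Type} {n : ℕ} (enc : V → List Sym) (t : Fin n → V) : List Sym :=
  (List.ofFn t).flatMap enc

/-- A row: its tuples one after the other, each preceded by its identifier. -/
def encRow {S : Schema} {D X : Type} (eD : D ↪ List Bool) (eX : X ↪ List Bool)
    {L : List (TupleId S)} (w : Row S D X L) : List Sym :=
  L.attach.flatMap (fun s => Sym.tup :: (encId s.1 ++ encTuple (encField eD eX) (w s))) ++
    [Sym.close]

/-- A component: the list of its tuple identifiers, then its rows. -/
def encComponent {S : Schema} {D X : Type} (eD : D ↪ List Bool) (eX : X ↪ List Bool)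
    (C : Component S D X) : List Sym :=
  encList Sym.tup encId C.ids ++ encList Sym.row (encRow eD eX) C.rows

/-- A gWSD: the list of its components, then its global condition. -/
def encGWSD {S : Schema} {D X : Type} (eD : D ↪ List Bool) (eX : X ↪ List Bool)
    (W : GWSD S D X) : List Sym :=
  encList Sym.comp (encComponent eD eX) W.comps ++ encList Sym.lit (encLiteral eD eX) W.cond

/-- A schema: the list of its arities. -/
def encSchema (S : Schema) : List Sym := encList Sym.arity encNat S.arities

/-- A fact `R(t)`. -/
def encFact {S : Schema} {D : Type} (eD : D ↪ List Bool) (f : (R : S.Rel) × Tuple S R D) :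
    List Sym :=
  encNat f.1 ++ encTuple (fun d => Sym.const :: encBits (eD d)) f.2

/-- An input of the instance certainty problem. -/
def encInput {D X : Type} (eD : D ↪ List Bool) (eX : X ↪ List Bool) (p : Input D X) : List Sym :=
  encSchema p.schema ++ encGWSD eD eX p.wsd ++ encList Sym.tup (encFact eD) p.inst

/-! ### Different inputs have different encodings -/

/-- An encoding whose code words can be read off unambiguously from the left. -/
def SelfDelim {α : Type} (enc : α → List Sym) : Prop :=
  ∀ x y r s, enc x ++ r = enc y ++ s → x = y ∧ r = s

theorem selfDelim_encBits : SelfDelim encBits := by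
  intro x
  induction x with
  | nil =>
    intro y r s h
    cases y <;> simp_all [encBits]
  | cons a x ih =>
    intro y r s h
    cases y with
    | nil => simp [encBits] at h
    | cons b y =>
      have h' : a = b ∧ encBits x ++ r = encBits y ++ s := by simpa [encBits] using h
      obtain ⟨h1, h2⟩ := ih y r s h'.2
      exact ⟨by rw [h'.1, h1], h2⟩

theorem selfDelim_encNat : SelfDelim encNat := by
  intro x y r s h
  obtain ⟨h1, h2⟩ := selfDelim_encBits _ _ r s h
  refine ⟨?_, h2⟩
  rw [← Computability.decode_encodeNat x, h1, Computability.decode_encodeNat]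

theorem selfDelim_encList {α : Type} {o : Sym} (ho : o ≠ Sym.close) {enc : α → List Sym}
    (he : SelfDelim enc) : SelfDelim (encList o enc) := by
  intro x
  induction x with
  | nil =>
    intro y r s h
    cases y with
    | nil => simpa [encList] using h
    | cons b y => simp [encList, ho.symm] at h
  | cons a x ih =>
    intro y r s h
    cases y with
    | nil => simp [encList, ho] at h
    | cons b y =>
      have h' : enc a ++ (encList o enc x ++ r) = enc b ++ (encList o enc y ++ s) := by
        simpa [encList] using h
      obtain ⟨h1, h2⟩ := he _ _ _ _ h'
      obtain ⟨h3, h4⟩ := ih _ _ _ h2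
      exact ⟨by rw [h1, h3], h4⟩

theorem flatMap_inj {β : Type} {f g : β → List Sym} {P : β → Prop}
    (H : ∀ b r s, f b ++ r = g b ++ s → P b ∧ r = s) (l : List β) :
    ∀ r s, l.flatMap f ++ r = l.flatMap g ++ s → (∀ b ∈ l, P b) ∧ r = s := by
  induction l with
  | nil => intro r s h; simpa using h
  | cons b l ih =>
    intro r s h
    have h' : f b ++ (l.flatMap f ++ r) = g b ++ (l.flatMap g ++ s) := by simpa using h
    obtain ⟨h1, h2⟩ := H _ _ _ h'
    obtain ⟨h3, h4⟩ := ih _ _ h2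
    exact ⟨by simpa using ⟨h1, h3⟩, h4⟩

theorem selfDelim_encTuple {V : Type} {n : ℕ} {enc : V → List Sym} (he : SelfDelim enc) :
    SelfDelim (encTuple (n := n) enc) := by
  intro x y r s h
  have key : (List.finRange n).flatMap (fun j => enc (x j)) ++ r =
      (List.finRange n).flatMap (fun j => enc (y j)) ++ s := by
    simpa [encTuple, List.ofFn_eq_map, List.flatMap_map] using h
  obtain ⟨h1, h2⟩ := flatMap_inj (P := fun j => x j = y j) (fun j r s h => he _ _ r s h) _ r s key
  exact ⟨funext fun j => h1 j (List.mem_finRange j), h2⟩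

theorem selfDelim_encTerm {D X : Type} (eD : D ↪ List Bool) (eX : X ↪ List Bool) :
    SelfDelim (encTerm eD eX) := by
  intro x y r s h
  cases x <;> cases y <;> simp only [encTerm, List.cons_append, List.cons.injEq, reduceCtorEq,
    false_and, true_and] at h
  all_goals
    obtain ⟨h1, h2⟩ := selfDelim_encBits _ _ r s h
    exact ⟨by simpa using h1, h2⟩

theorem selfDelim_encField {D X : Type} (eD : D ↪ List Bool) (eX : X ↪ List Bool) :
    SelfDelim (encField eD eX) := by
  intro x y r s h
  rcases x with _ | x <;> rcases y with _ | y
  · simpa [encField] using h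
  · cases y <;> simp [encField, encTerm] at h
  · cases x <;> simp [encField, encTerm] at h
  · obtain ⟨h1, h2⟩ := selfDelim_encTerm eD eX x y r s h
    exact ⟨by rw [h1], h2⟩

theorem selfDelim_encLiteral {D X : Type} (eD : D ↪ List Bool) (eX : X ↪ List Bool) :
    SelfDelim (encLiteral eD eX) := by
  rintro ⟨b, l1, l2⟩ ⟨c, m1, m2⟩ r s h
  have h' : b = c ∧ encTerm eD eX l1 ++ (encTerm eD eX l2 ++ r) =
      encTerm eD eX m1 ++ (encTerm eD eX m2 ++ s) := by
    cases b <;> cases c <;> simpa [encLiteral] using h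
  obtain ⟨h1, h2⟩ := selfDelim_encTerm eD eX _ _ _ _ h'.2
  obtain ⟨h3, h4⟩ := selfDelim_encTerm eD eX _ _ _ _ h2
  exact ⟨by rw [h'.1, h1, h3], h4⟩

theorem selfDelim_encId {S : Schema} : SelfDelim (encId (S := S)) := by
  rintro ⟨R, d⟩ ⟨R', d'⟩ r s h
  simp only [encId, List.append_assoc] at h
  obtain ⟨h1, h2⟩ := selfDelim_encNat _ _ _ _ h
  obtain ⟨h3, h4⟩ := selfDelim_encNat _ _ _ _ h2
  exact ⟨by rw [h1, Fin.ext h3], h4⟩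

theorem selfDelim_encRow {S : Schema} {D X : Type} (eD : D ↪ List Bool) (eX : X ↪ List Bool)
    {L : List (TupleId S)} : SelfDelim (encRow (L := L) eD eX) := by
  intro w w' r s h
  simp only [encRow, List.append_assoc] at h
  obtain ⟨h1, h2⟩ := flatMap_inj (P := fun b => w b = w' b) (by
    intro b r s h
    simp only [List.cons_append, List.cons.injEq, true_and, List.append_assoc,
      List.append_cancel_left_eq] at h
    exact selfDelim_encTuple (selfDelim_encField eD eX) _ _ _ _ h) _ _ _ h
  exact ⟨funext fun b => h1 b (List.mem_attach _ b), by simpa using h2⟩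

theorem selfDelim_encComponent {S : Schema} {D X : Type} (eD : D ↪ List Bool)
    (eX : X ↪ List Bool) : SelfDelim (encComponent (S := S) eD eX) := by
  rintro ⟨L, hL, rows⟩ ⟨L', hL', rows'⟩ r s h
  simp only [encComponent, List.append_assoc] at h
  obtain ⟨h1, h2⟩ := selfDelim_encList (by decide) selfDelim_encId _ _ _ _ h
  subst h1
  obtain ⟨h3, h4⟩ := selfDelim_encList (by decide) (selfDelim_encRow eD eX) _ _ _ _ h2
  exact ⟨by rw [h3], h4⟩

theorem selfDelim_encGWSD {S : Schema} {D X : Type} (eD : D ↪ List Bool)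
    (eX : X ↪ List Bool) : SelfDelim (encGWSD (S := S) eD eX) := by
  rintro ⟨cs, hc, φ⟩ ⟨cs', hc', φ'⟩ r s h
  simp only [encGWSD, List.append_assoc] at h
  obtain ⟨h1, h2⟩ := selfDelim_encList (by decide) (selfDelim_encComponent eD eX) _ _ _ _ h
  obtain ⟨h3, h4⟩ := selfDelim_encList (by decide) (selfDelim_encLiteral eD eX) _ _ _ _ h2
  subst h1 h3
  exact ⟨rfl, h4⟩

theorem selfDelim_encSchema : SelfDelim encSchema := by
  rintro ⟨a, ha⟩ ⟨b, hb⟩ r s h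
  obtain ⟨h1, h2⟩ := selfDelim_encList (by decide) selfDelim_encNat _ _ _ _ h
  subst h1
  exact ⟨rfl, h2⟩

theorem selfDelim_encFact {S : Schema} {D : Type} (eD : D ↪ List Bool) :
    SelfDelim (encFact (S := S) eD) := by
  rintro ⟨R, t⟩ ⟨R', t'⟩ r s h
  simp only [encFact, List.append_assoc] at h
  obtain ⟨h1, h2⟩ := selfDelim_encNat _ _ _ _ h
  have h1' := Fin.ext h1
  subst h1'
  obtain ⟨h3, h4⟩ := selfDelim_encTuple (by
    intro x y r s h
    simp only [List.cons_append, List.cons.injEq, true_and] at h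
    obtain ⟨h1, h2⟩ := selfDelim_encBits _ _ r s h
    exact ⟨eD.injective h1, h2⟩) _ _ _ _ h2
  exact ⟨by rw [h3], h4⟩

theorem encInput_injective {D X : Type} (eD : D ↪ List Bool) (eX : X ↪ List Bool) :
    Function.Injective (encInput eD eX) := by
  rintro ⟨S, W, I⟩ ⟨S', W', I'⟩ h
  simp only [encInput, List.append_assoc] at h
  obtain ⟨h1, h2⟩ := selfDelim_encSchema _ _ _ _ h
  subst h1
  obtain ⟨h3, h4⟩ := selfDelim_encGWSD eD eX _ _ _ _ h2
  obtain ⟨h5, -⟩ := selfDelim_encList (o := Sym.tup) (by decide) (selfDelim_encFact eD) I I' [] []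
    (by simpa using h4)
  rw [h3, h5]

/-! ### Polynomial time -/

/-- A decision problem on `α` is in PTIME with respect to an encoding of its inputs by strings:
a Turing machine outputs its truth value within polynomially many steps in the length of the
encoded input. -/
def InPTIME {α Γ : Type} (enc : α → List Γ) (P : α → Prop) : Prop :=
  ∃ f : α → Bool, (∀ a, f a = true ↔ P a) ∧
    Nonempty (Turing.TM2ComputableInPolyTime enc Computability.encodeBool f)

end WSD

/-!
Solving the equations of the condition turns it into a substitution `θ` together with the
requirement that no inequation collapses under `θ`. If that fails, or if some component has no rows,
there are no worlds. Otherwise some valuation satisfying the condition gives distinct fresh values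
to the variables that `θ` leaves, so that it identifies two tuples only if `θ` does. Hence `W` is
certainly equal to `I` exactly if `θ` turns every tuple without `⊥` in every row into a fact of `I`,
and every fact of `I` has a component each of whose rows contains a tuple that `θ` turns into this
fact: if every component had a row missing the fact, these rows could be chosen simultaneously.

This test takes polynomially many steps on finite trees. A tree is a postfix string of tokens, and
the tree operations are structured programs on a few stacks, each of which is compiled to a Turing
machine with these stacks.
-/

/-! ### Stack programs and their machines -/

namespace StackMachine

open Turing Function StateTransition

/-- Structured programs on a family of stacks, where the stack `k` has the alphabet `Γ k`. The
guards of branches and loops inspect the topmost symbol of one stack. -/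
inductive Prog {K : Type} (Γ : K → Type) where
  | skip
  | push (k : K) (a : Γ k)
  | pop (k : K)
  | seq (P Q : Prog Γ)
  | ite (k : K) (p : Option (Γ k) → Bool) (P Q : Prog Γ)
  | loop (k : K) (p : Option (Γ k) → Bool) (P : Prog Γ)

namespace Prog

variable {K : Type} {Γ : K → Type}

/-- Big-step semantics: `Run P S S' n` says that the program `P` turns the stacks `S` into `S'`
within at most `n` steps. -/
inductive Run [DecidableEq K] : Prog Γ → (∀ k, List (Γ k)) → (∀ k, List (Γ k)) → ℕ → Prop where
  | skip {S} : Run skip S S 1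
  | push {k a S} : Run (push k a) S (update S k (a :: S k)) 1
  | pop {k S} : Run (pop k) S (update S k (S k).tail) 1
  | seq {P Q S S' S'' m n} : Run P S S' m → Run Q S' S'' n → Run (seq P Q) S S'' (m + n)
  | ite_true {k p P Q S S' n} : p (S k).head? = true → Run P S S' n →
      Run (ite k p P Q) S S' (n + 1)
  | ite_false {k p P Q S S' n} : p (S k).head? = false → Run Q S S' n →
      Run (ite k p P Q) S S' (n + 1)
  | loop_false {k p P S} : p (S k).head? = false → Run (loop k p P) S S 1
  | loop_true {k p P S S' S'' m n} : p (S k).head? = true → Run P S S' m →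
      Run (loop k p P) S' S'' n → Run (loop k p P) S S'' (m + n + 1)
  | mono {P S S' m n} : Run P S S' m → m ≤ n → Run P S S' n

/-- The control locations of a program, which become labels of its machine. -/
def Label : Prog Γ → Type
  | skip => Unit
  | push _ _ => Unit
  | pop _ => Unit
  | seq P Q => Label P ⊕ Label Q
  | ite _ _ P Q => Option (Label P ⊕ Label Q)
  | .loop _ _ P => Option (Label P)

/-- The control location at which the execution of a program starts. -/
def entry : (P : Prog Γ) → Label P
  | skip => ()
  | push _ _ => ()
  | pop _ => ()
  | seq P _ => .inl (entry P)
  | ite _ _ _ _ => none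
  | .loop _ _ _ => none

instance labelFintype : (P : Prog Γ) → Fintype (Label P)
  | skip => inferInstanceAs (Fintype Unit)
  | push _ _ => inferInstanceAs (Fintype Unit)
  | pop _ => inferInstanceAs (Fintype Unit)
  | seq P Q =>
    let _ := labelFintype P
    let _ := labelFintype Q
    inferInstanceAs (Fintype (Label P ⊕ Label Q))
  | ite _ _ P Q =>
    let _ := labelFintype P
    let _ := labelFintype Q
    inferInstanceAs (Fintype (Option (Label P ⊕ Label Q)))
  | .loop _ _ P =>
    let _ := labelFintype P
    inferInstanceAs (Fintype (Option (Label P)))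

/-- The machine statement that jumps to `l₁` or `l₂`, depending on the topmost symbol of a stack.
The internal state of the machine is a Boolean, which only serves to pass the result of the test to
the branch and is `false` otherwise. -/
def test {Λ : Type} (k : K) (p : Option (Γ k) → Bool) (l₁ l₂ : Λ) : TM2.Stmt Γ Λ Bool :=
  .peek k (fun _ o => p o) (.branch id
    (.load (fun _ => false) (.goto fun _ => l₁)) (.load (fun _ => false) (.goto fun _ => l₂)))

/-- The machine code of a program as a part of a machine with labels `Λ`: the embedding `φ` names
the control locations of the program, and `e` is the label at which the execution continues. -/
def stmt {Λ : Type} : (P : Prog Γ) → (φ : Label P → Λ) → (e : Λ) → Label P → TM2.Stmt Γ Λ Bool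
  | skip, _, e, _ => .goto fun _ => e
  | push k a, _, e, _ => .push k (fun _ => a) (.goto fun _ => e)
  | pop k, _, e, _ => .pop k (fun v _ => v) (.goto fun _ => e)
  | seq P Q, φ, _, .inl l => stmt P (fun l => φ (.inl l)) (φ (.inr (entry Q))) l
  | seq _ Q, φ, e, .inr l => stmt Q (fun l => φ (.inr l)) e l
  | ite k p P Q, φ, _, none =>
    test k p (φ (some (.inl (entry P)))) (φ (some (.inr (entry Q))))
  | ite _ _ P _, φ, e, some (.inl l) => stmt P (fun l => φ (some (.inl l))) e l
  | ite _ _ _ Q, φ, e, some (.inr l) => stmt Q (fun l => φ (some (.inr l))) e l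
  | .loop k p P, φ, e, none => test k p (φ (some (entry P))) e
  | .loop _ _ P, φ, _, some l => stmt P (fun l => φ (some l)) (φ none) l

/-- The machine that runs a program and halts. -/
def machine (P : Prog Γ) : Option (Label P) → TM2.Stmt Γ (Option (Label P)) Bool
  | some l => stmt P some none l
  | none => .halt

variable [DecidableEq K]

theorem nonempty_evalsToInTime_head {σ : Type} {f : σ → Option σ} {a b : σ} {c : Option σ} {n : ℕ}
    (hab : f a = some b) (hbc : Nonempty (EvalsToInTime f b c n)) :
    Nonempty (EvalsToInTime f a c (n + 1)) :=
  let ⟨h⟩ := hbc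
  ⟨.trans _ 1 n a b c ⟨⟨1, by simpa [flip] using hab⟩, le_rfl⟩ h⟩

theorem nonempty_evalsToInTime_trans {σ : Type} {f : σ → Option σ} {a b : σ} {c : Option σ}
    {m n : ℕ} (hab : Nonempty (EvalsToInTime f a (some b) m))
    (hbc : Nonempty (EvalsToInTime f b c n)) : Nonempty (EvalsToInTime f a c (m + n)) :=
  let ⟨h⟩ := hab
  let ⟨h'⟩ := hbc
  ⟨m.add_comm n ▸ .trans _ m n a b c h h'⟩

theorem Run.nonempty_evalsToInTime {P : Prog Γ} {S S' : ∀ k, List (Γ k)} {n : ℕ}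
    (h : Run P S S' n) {Λ : Type} (M : Λ → TM2.Stmt Γ Λ Bool) (φ : Label P → Λ) (e : Λ)
    (hM : ∀ l, M (φ l) = stmt P φ e l) :
    Nonempty (EvalsToInTime (TM2.step M) ⟨some (φ (entry P)), false, S⟩
      (some ⟨some e, false, S'⟩) n) := by
  induction h generalizing e with
  | skip | push | pop =>
    exact nonempty_evalsToInTime_head (by rw [TM2.step, hM]; rfl) ⟨.refl _ _⟩
  | seq _ _ ihP ihQ =>
    exact nonempty_evalsToInTime_trans (ihP (fun l => φ (.inl l)) _ fun l => hM (.inl l))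
      (ihQ (fun l => φ (.inr l)) _ fun l => hM (.inr l))
  | ite_true hp _ ih =>
    refine nonempty_evalsToInTime_head ?_
      (ih (fun l => φ (some (.inl l))) _ fun l => hM (some (.inl l)))
    rw [TM2.step, hM]
    simp [entry, stmt, test, hp]
  | ite_false hp _ ih =>
    refine nonempty_evalsToInTime_head ?_
      (ih (fun l => φ (some (.inr l))) _ fun l => hM (some (.inr l)))
    rw [TM2.step, hM]
    simp [entry, stmt, test, hp]
  | loop_false hp =>
    refine nonempty_evalsToInTime_head ?_ ⟨.refl _ _⟩
    rw [TM2.step, hM]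
    simp [entry, stmt, test, hp]
  | loop_true hp _ _ ih ih' =>
    refine nonempty_evalsToInTime_head ?_ (nonempty_evalsToInTime_trans
      (ih (fun l => φ (some l)) _ fun l => hM (some l)) (ih' φ e hM))
    rw [TM2.step, hM]
    simp [entry, stmt, test, hp]
  | mono _ hmn ih =>
    obtain ⟨h⟩ := ih φ e hM
    exact ⟨⟨h.toEvalsTo, h.steps_le_m.trans hmn⟩⟩

theorem Run.nonempty_machine_evalsToInTime {P : Prog Γ} {S S' : ∀ k, List (Γ k)} {n : ℕ}
    (h : Run P S S' n) : Nonempty (EvalsToInTime (TM2.step P.machine)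
      ⟨some (some (entry P)), false, S⟩ (some ⟨none, false, S'⟩) (n + 1)) :=
  nonempty_evalsToInTime_trans (h.nonempty_evalsToInTime P.machine some none fun _ => rfl)
    (nonempty_evalsToInTime_head rfl ⟨.refl _ _⟩)

theorem Run.length_le {P : Prog Γ} {S S' : ∀ k, List (Γ k)} {n : ℕ} (h : Run P S S' n) (k : K) :
    (S' k).length ≤ (S k).length + n := by
  induction h with
  | skip | loop_false => omega
  | @push j =>
    obtain rfl | hk := eq_or_ne k j
    · simp
    · simp [hk]
  | @pop j =>
    obtain rfl | hk := eq_or_ne k j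
    · rw [update_self, List.length_tail]; omega
    · simp [hk]
  | seq | ite_true | ite_false | loop_true | mono => omega

end Prog

/-! ### Trees on stacks -/

/-- The symbols of the Polish notation of binary trees. -/
inductive Tok where
  | leaf | node

/-- The Polish notation of a binary tree. -/
def polish : BinaryTree Unit → List Tok
  | .nil => [.leaf]
  | .node _ s t => .node :: (polish s ++ polish t)

/-- The stacks: the input, the output, the main work stack, and three auxiliary stacks that are
empty between any two operations on trees. -/
inductive Stk where
  | inp | out | main | aux | tmp | cnt
  deriving DecidableEq

instance : Fintype Stk where
  elems := {.inp, .out, .main, .aux, .tmp, .cnt}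
  complete k := by cases k <;> simp

/-- The stack alphabets, for inputs over `I`. -/
def Alphabet (I : Type) : Stk → Type
  | .inp => I
  | .out => Bool
  | _ => Tok

variable {I : Type}

/-- The family of stacks with the given contents. -/
def st (i : List I) (o : List Bool) (m a b c : List Tok) : (k : Stk) → List (Alphabet I k)
  | .inp => i
  | .out => o
  | .main => m
  | .aux => a
  | .tmp => b
  | .cnt => c

/-- The stacks between two operations on trees: only the input and the main stack are in use. -/
abbrev work (i : List I) (m : List Tok) : (k : Stk) → List (Alphabet I k) := st i [] m [] [] []

/-- The guard that tests whether the topmost symbol is a leaf. -/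
def isLeaf : Option Tok → Bool
  | some .leaf => true
  | _ => false

/-- The guard that tests whether the topmost symbol is a node. -/
def isNode : Option Tok → Bool
  | some .node => true
  | _ => false

namespace Prog

theorem Run.push_st {S S' : ∀ k, List (Alphabet I k)} {k : Stk} {x : Alphabet I k}
    (h : ∀ j, update S k (x :: S k) j = S' j) : Run (.push k x) S S' 1 :=
  funext h ▸ .push

theorem Run.pop_st {S S' : ∀ k, List (Alphabet I k)} {k : Stk}
    (h : ∀ j, update S k (S k).tail j = S' j) : Run (.pop k) S S' 1 :=
  funext h ▸ .pop

section

variable {i : List I} {o : List Bool} {m a b c : List Tok} {s : Tok}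

theorem run_push_main : Run (.push Stk.main s) (st i o m a b c) (st i o (s :: m) a b c) 1 :=
  .push_st (by rintro ⟨⟩ <;> rfl)

theorem run_push_aux : Run (.push Stk.aux s) (st i o m a b c) (st i o m (s :: a) b c) 1 :=
  .push_st (by rintro ⟨⟩ <;> rfl)

theorem run_push_tmp : Run (.push Stk.tmp s) (st i o m a b c) (st i o m a (s :: b) c) 1 :=
  .push_st (by rintro ⟨⟩ <;> rfl)

theorem run_push_cnt : Run (.push Stk.cnt s) (st i o m a b c) (st i o m a b (s :: c)) 1 :=
  .push_st (by rintro ⟨⟩ <;> rfl)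

theorem run_push_out {x : Bool} :
    Run (.push Stk.out x) (st i o m a b c) (st i (x :: o) m a b c) 1 :=
  .push_st (by rintro ⟨⟩ <;> rfl)

theorem run_pop_main : Run (.pop Stk.main) (st i o (s :: m) a b c) (st i o m a b c) 1 :=
  .pop_st (by rintro ⟨⟩ <;> rfl)

theorem run_pop_aux : Run (.pop Stk.aux) (st i o m a b c) (st i o m a.tail b c) 1 :=
  .pop_st (by rintro ⟨⟩ <;> rfl)

theorem run_pop_tmp : Run (.pop Stk.tmp) (st i o m a b c) (st i o m a b.tail c) 1 :=
  .pop_st (by rintro ⟨⟩ <;> rfl)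

theorem run_pop_cnt : Run (.pop Stk.cnt) (st i o m a b (s :: c)) (st i o m a b c) 1 :=
  .pop_st (by rintro ⟨⟩ <;> rfl)

theorem run_pop_inp {x : I} : Run (.pop Stk.inp) (st (x :: i) o m a b c) (st i o m a b c) 1 :=
  .pop_st (by rintro ⟨⟩ <;> rfl)

end

/-- The loop of `scan`: the height of the stack `cnt` is the number of trees still to be read. -/
def scanLoop (P : Tok → Prog (Alphabet I)) : Prog (Alphabet I) :=
  .loop Stk.cnt (fun o => o.isSome) (.ite Stk.main isLeaf
    (.seq (.pop Stk.main) (.seq (P .leaf) (.pop Stk.cnt)))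
    (.seq (.pop Stk.main) (.seq (P .node) (.push Stk.cnt Tok.leaf))))

/-- Remove the topmost tree from the main stack and run `P s` for each of its symbols `s`. -/
def scan (P : Tok → Prog (Alphabet I)) : Prog (Alphabet I) :=
  .seq (.push Stk.cnt Tok.leaf) (scanLoop P)

theorem run_scanLoop {P : Tok → Prog (Alphabet I)} {i : List I} (A B : List Tok → List Tok) {d : ℕ}
    (hP : ∀ s l r c, Run (P s) (st i [] r (A l) (B l) c) (st i [] r (A (s :: l)) (B (s :: l)) c) d)
    (t : BinaryTree Unit) : ∀ {r l c S n},
      Run (scanLoop P) (st i [] r (A ((polish t).reverse ++ l)) (B ((polish t).reverse ++ l)) c)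
        S n →
      Run (scanLoop P) (st i [] (polish t ++ r) (A l) (B l) (Tok.leaf :: c)) S
        ((d + 4) * (polish t).length + n) := by
  induction t with
  | nil =>
    intro r l c S n h
    refine (Run.loop_true (S := st i [] (Tok.leaf :: r) _ _ (Tok.leaf :: c)) rfl
      (.ite_true rfl (.seq run_pop_main (.seq (hP ..) run_pop_cnt))) h).mono ?_
    simp only [polish, List.length_singleton]
    omega
  | node _ t u iht ihu =>
    intro r l c S n h
    have h' := @iht (polish u ++ r) (Tok.node :: l) (Tok.leaf :: c) S
      ((d + 4) * (polish u).length + n) (ihu (by simpa [polish] using h))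
    have h'' := Run.loop_true (k := Stk.cnt)
      (S := st i [] (Tok.node :: (polish t ++ (polish u ++ r))) _ _ (Tok.leaf :: c)) rfl
      (.ite_false rfl (.seq run_pop_main (.seq (hP ..) run_push_cnt))) h'
    refine Run.mono (by simpa [polish, scanLoop] using h'') ?_
    simp only [polish, List.length_cons, List.length_append]
    ring_nf
    omega

theorem run_scan {P : Tok → Prog (Alphabet I)} {i : List I} {r : List Tok}
    (A B : List Tok → List Tok) {d : ℕ}
    (hP : ∀ s l r c, Run (P s) (st i [] r (A l) (B l) c) (st i [] r (A (s :: l)) (B (s :: l)) c) d)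
    (t : BinaryTree Unit) :
    Run (scan P) (st i [] (polish t ++ r) (A []) (B []) [])
      (st i [] r (A (polish t).reverse) (B (polish t).reverse) [])
      ((d + 4) * (polish t).length + 2) :=
  (Run.seq run_push_cnt (run_scanLoop A B hP t (by simpa using .loop_false rfl))).mono (by omega)

/-- Move the contents of the stack `aux` to the main stack. -/
def drainAux : Prog (Alphabet I) :=
  .loop Stk.aux (fun o => o.isSome) (.ite Stk.aux isLeaf
    (.seq (.pop Stk.aux) (.push Stk.main Tok.leaf)) (.seq (.pop Stk.aux) (.push Stk.main Tok.node)))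

/-- Move the contents of the stack `tmp` to the main stack. -/
def drainTmp : Prog (Alphabet I) :=
  .loop Stk.tmp (fun o => o.isSome) (.ite Stk.tmp isLeaf
    (.seq (.pop Stk.tmp) (.push Stk.main Tok.leaf)) (.seq (.pop Stk.tmp) (.push Stk.main Tok.node)))

theorem run_drainAux {i : List I} {o : List Bool} {b c : List Tok} (l m : List Tok) :
    Run drainAux (st i o m l b c) (st i o (l.reverse ++ m) [] b c) (4 * l.length + 1) := by
  induction l generalizing m with
  | nil => exact .loop_false rfl
  | cons s l ih =>
    rw [List.reverse_cons, List.append_assoc]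
    refine .mono (.loop_true (m := 3) rfl ?_ (ih (s :: m))) (by rw [List.length_cons]; omega)
    cases s
    · exact .ite_true rfl (.seq run_pop_aux run_push_main)
    · exact .ite_false rfl (.seq run_pop_aux run_push_main)

theorem run_drainTmp {i : List I} {o : List Bool} {a c : List Tok} (l m : List Tok) :
    Run drainTmp (st i o m a l c) (st i o (l.reverse ++ m) a [] c) (4 * l.length + 1) := by
  induction l generalizing m with
  | nil => exact .loop_false rfl
  | cons s l ih =>
    rw [List.reverse_cons, List.append_assoc]
    refine .mono (.loop_true (m := 3) rfl ?_ (ih (s :: m))) (by rw [List.length_cons]; omega)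
    cases s
    · exact .ite_true rfl (.seq run_pop_tmp run_push_main)
    · exact .ite_false rfl (.seq run_pop_tmp run_push_main)

/-- Remove the topmost tree. -/
def drop : Prog (Alphabet I) := scan fun _ => .skip

/-- Duplicate the topmost tree. -/
def dup : Prog (Alphabet I) :=
  .seq (scan fun s => .seq (.push Stk.aux s) (.push Stk.tmp s)) (.seq drainAux drainTmp)

/-- Exchange the two topmost trees. -/
def swap : Prog (Alphabet I) :=
  .seq (scan fun s => .push Stk.aux s) (.seq (scan fun s => .push Stk.tmp s)
    (.seq drainAux drainTmp))

theorem run_drop {i : List I} {r : List Tok} (t : BinaryTree Unit) :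
    Run drop (work i (polish t ++ r)) (work i r) (5 * (polish t).length + 2) :=
  run_scan (fun _ => []) (fun _ => []) (fun _ _ _ _ => .skip) t

theorem run_dup {i : List I} {r : List Tok} (t : BinaryTree Unit) :
    Run dup (work i (polish t ++ r)) (work i (polish t ++ (polish t ++ r)))
      (14 * (polish t).length + 4) := by
  have hscan := run_scan (i := i) (r := r) id id
    (fun _ _ _ _ => .seq run_push_aux run_push_tmp) t
  have hdrain := run_drainTmp (i := i) (o := []) (a := []) (c := []) (polish t).reverse
    ((polish t).reverse.reverse ++ r)
  simp only [List.reverse_reverse] at hdrain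
  refine (hscan.seq ((run_drainAux _ _).seq (by simpa using hdrain))).mono ?_
  simp only [id, List.length_reverse]
  omega

theorem run_swap {i : List I} {r : List Tok} (t u : BinaryTree Unit) :
    Run swap (work i (polish t ++ (polish u ++ r))) (work i (polish u ++ (polish t ++ r)))
      (9 * ((polish t).length + (polish u).length) + 6) := by
  have hscan := run_scan (i := i) (r := polish u ++ r) id (fun _ => [])
    (fun _ _ _ _ => run_push_aux) t
  have hscan' := run_scan (i := i) (r := r) (fun _ => (polish t).reverse) id
    (fun _ _ _ _ => run_push_tmp) u
  have hdrain := run_drainTmp (i := i) (o := []) (a := []) (c := []) (polish u).reverse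
    ((polish t).reverse.reverse ++ r)
  simp only [List.reverse_reverse] at hdrain
  refine (hscan.seq (hscan'.seq ((run_drainAux _ _).seq (by simpa using hdrain)))).mono ?_
  simp only [List.length_reverse]
  omega

end Prog

/-! ### Encodings by trees -/

/-- An injective encoding of the elements of a type by binary trees. -/
class TreeEncodable (α : Type) where
  toTree : α → BinaryTree Unit
  toTree_injective : Injective toTree

open TreeEncodable

/-- The encoding of pairs by trees. -/
def pairTree {α β : Type} [TreeEncodable α] [TreeEncodable β] (p : α × β) : BinaryTree Unit :=
  .node () (toTree p.1) (toTree p.2)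

/-- The encoding of lists by trees. -/
def listTree {α : Type} [TreeEncodable α] : List α → BinaryTree Unit
  | [] => .nil
  | a :: l => .node () (toTree a) (listTree l)

theorem listTree_injective {α : Type} [TreeEncodable α] :
    Injective (listTree : List α → BinaryTree Unit)
  | [], [], _ => rfl
  | a :: l, b :: m, h => by
    injection h with _ ha hl
    rw [toTree_injective ha, listTree_injective hl]

instance {α β : Type} [TreeEncodable α] [TreeEncodable β] : TreeEncodable (α × β) where
  toTree := pairTree
  toTree_injective p q h := by
    injection h with _ h₁ h₂
    exact Prod.ext (toTree_injective h₁) (toTree_injective h₂)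

instance {α : Type} [TreeEncodable α] : TreeEncodable (List α) := ⟨listTree, listTree_injective⟩

instance : TreeEncodable Unit := ⟨fun _ => .nil, injective_of_subsingleton _⟩

instance : TreeEncodable Bool where
  toTree b := cond b (.node () .nil .nil) .nil
  toTree_injective a b h := by cases a <;> cases b <;> simp_all

/-- The string on the main stack that represents an element. -/
def code {α : Type} [TreeEncodable α] (x : α) : List Tok := polish (toTree x)

/-- The size of the representation of an element. -/
def size {α : Type} [TreeEncodable α] (x : α) : ℕ := (code x).length

section

variable {α β : Type} [TreeEncodable α] [TreeEncodable β]

theorem code_pair (a : α) (b : β) : code (a, b) = .node :: (code a ++ code b) := rfl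

theorem code_cons (a : α) (l : List α) : code (a :: l) = .node :: (code a ++ code l) := rfl

theorem size_pair (a : α) (b : β) : size (a, b) = size a + size b + 1 := by
  simp [size, code_pair]

theorem size_nil : size ([] : List α) = 1 := rfl

theorem size_cons (a : α) (l : List α) : size (a :: l) = size a + size l + 1 := by
  simp [size, code_cons]

theorem length_lt_size (l : List α) : l.length < size l := by
  induction l with
  | nil => exact zero_lt_one
  | cons a l ih => rw [List.length_cons, size_cons]; omega

theorem size_lt_of_mem {a : α} {l : List α} (h : a ∈ l) : size a < size l := by
  induction l with
  | nil => cases h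
  | cons b l ih =>
    rw [size_cons]
    obtain rfl | h := List.mem_cons.1 h
    · omega
    · have := ih h
      omega

theorem size_le_of_forall_mem {l : List α} {N : ℕ} (h : ∀ a ∈ l, size a ≤ N) :
    size l ≤ l.length * (N + 1) + 1 := by
  induction l with
  | nil => simp [size_nil]
  | cons a l ih =>
    have hl := ih fun b hb => h b (.tail _ hb)
    have ha := h a (.head _)
    rw [size_cons, List.length_cons, Nat.succ_mul]
    omega

theorem size_append (l m : List α) : size (l ++ m) + 1 = size l + size m := by
  induction l with
  | nil => simp [size_nil, add_comm]
  | cons a l ih => rw [List.cons_append, size_cons, size_cons]; omega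

theorem size_headD_add_size_tail_le (l : List α) (a : α) :
    size (l.headD a) + size l.tail ≤ size l + size a := by
  cases l with
  | nil => exact (add_comm _ _).le
  | cons c l => rw [size_cons, List.headD_cons, List.tail_cons]; omega

theorem size_headD_reverse_le (l : List α) (a : α) :
    size (l.reverse.headD a) ≤ size l + size a := by
  rcases h : l.reverse with _ | ⟨c, m⟩
  · exact Nat.le_add_left _ _
  · have hc : c ∈ l := List.mem_reverse.1 (by simp [h])
    exact (size_lt_of_mem hc).le.trans (Nat.le_add_right _ _)

end

/-! ### Polynomial bounds -/

/-- Functions to `ℕ` that are bounded by a polynomial in the size of the argument. -/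
@[fun_prop]
def PolyBounded {α : Type} [TreeEncodable α] (T : α → ℕ) : Prop :=
  ∃ p : Polynomial ℕ, ∀ x, T x ≤ p.eval (size x)

theorem polynomial_eval_mono (p : Polynomial ℕ) : Monotone (p.eval ·) := fun m n h => by
  simp only [Polynomial.eval_eq_sum_range]
  gcongr

namespace PolyBounded

variable {α β : Type} [TreeEncodable α] [TreeEncodable β] {T U : α → ℕ}

theorem mono (hU : PolyBounded U) (h : ∀ x, T x ≤ U x) : PolyBounded T :=
  let ⟨p, hp⟩ := hU
  ⟨p, fun x => (h x).trans (hp x)⟩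

@[fun_prop]
protected theorem size : PolyBounded (size : α → ℕ) := ⟨.X, fun x => by simp⟩

@[fun_prop]
theorem const (n : ℕ) : PolyBounded fun _ : α => n := ⟨.C n, fun x => by simp⟩

@[fun_prop]
theorem add (hT : PolyBounded T) (hU : PolyBounded U) : PolyBounded fun x => T x + U x :=
  let ⟨p, hp⟩ := hT
  let ⟨q, hq⟩ := hU
  ⟨p + q, fun x => by simpa using add_le_add (hp x) (hq x)⟩

@[fun_prop]
theorem mul (hT : PolyBounded T) (hU : PolyBounded U) : PolyBounded fun x => T x * U x :=
  let ⟨p, hp⟩ := hT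
  let ⟨q, hq⟩ := hU
  ⟨p * q, fun x => by simpa using mul_le_mul' (hp x) (hq x)⟩

theorem eval (hT : PolyBounded T) (p : Polynomial ℕ) : PolyBounded fun x => p.eval (T x) :=
  let ⟨q, hq⟩ := hT
  ⟨p.comp q, fun x => by simpa using polynomial_eval_mono p (hq x)⟩

theorem comp {T : β → ℕ} (hT : PolyBounded T) {f : α → β} (hf : PolyBounded fun x => size (f x)) :
    PolyBounded fun x => T (f x) :=
  let ⟨p, hp⟩ := hT
  (hf.eval p).mono fun x => hp (f x)

end PolyBounded

/-! ### Functions computable in polynomial time -/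

/-- Functions that a program for inputs over `I` computes in polynomial time, replacing the topmost
tree of the main stack. -/
@[fun_prop]
def PolyTime (I : Type) {α β : Type} [TreeEncodable α] [TreeEncodable β] (f : α → β) : Prop :=
  ∃ (P : Prog (Alphabet I)) (T : α → ℕ), PolyBounded T ∧
    ∀ x i r, P.Run (work i (code x ++ r)) (work i (code (f x) ++ r)) (T x)

namespace Prog

variable {α β : Type} [TreeEncodable α] [TreeEncodable β] {i : List I} {r : List Tok}

theorem run_drop_code (x : α) : Run drop (work i (code x ++ r)) (work i r) (5 * size x + 2) :=
  run_drop _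

theorem run_dup_code (x : α) :
    Run dup (work i (code x ++ r)) (work i (code x ++ (code x ++ r))) (14 * size x + 4) :=
  run_dup _

theorem run_swap_code (x : α) (y : β) : Run swap (work i (code x ++ (code y ++ r)))
    (work i (code y ++ (code x ++ r))) (9 * (size x + size y) + 6) :=
  run_swap _ _

end Prog

namespace PolyTime

open Prog

variable {α β γ δ : Type} [TreeEncodable α] [TreeEncodable β] [TreeEncodable γ] [TreeEncodable δ]

theorem polyBounded_size {f : α → β} (hf : PolyTime I f) : PolyBounded fun x => size (f x) := by
  obtain ⟨P, T, hT, h⟩ := hf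
  refine (PolyBounded.add .size hT).mono fun x => ?_
  have hlen := (h x [] []).length_le Stk.main
  rwa [work, work, st, st, List.append_nil, List.append_nil] at hlen

theorem of_toTree_eq {α' β' : Type} [TreeEncodable α'] [TreeEncodable β'] {f : α → β}
    (hf : PolyTime I f) {g : α' → β'} (e : α' → α) (he : ∀ x, toTree (e x) = toTree x)
    (hg : ∀ x, toTree (g x) = toTree (f (e x))) : PolyTime I g := by
  obtain ⟨P, T, hT, h⟩ := hf
  have hcode : ∀ x, code (e x) = code x := fun x => congrArg polish (he x)
  refine ⟨P, fun x => T (e x), hT.comp (PolyBounded.size.mono fun x => ?_), fun x i r => ?_⟩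
  · rw [size, size, hcode]
  · rw [← hcode, show code (g x) = code (f (e x)) from congrArg polish (hg x)]
    exact h (e x) i r

@[fun_prop]
protected theorem id : PolyTime I (fun x : α => x) := ⟨.skip, _, .const 1, fun _ _ _ => .skip⟩

@[fun_prop]
theorem comp {g : β → γ} (hg : PolyTime I g) {f : α → β} (hf : PolyTime I f) :
    PolyTime I fun x => g (f x) := by
  have hsize := hf.polyBounded_size
  obtain ⟨P, T, hT, hP⟩ := hf
  obtain ⟨Q, U, hU, hQ⟩ := hg
  exact ⟨.seq P Q, _, hT.add (hU.comp hsize), fun x i r => (hP x i r).seq (hQ (f x) i r)⟩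

@[fun_prop]
theorem pair {f : α → β} (hf : PolyTime I f) {g : α → γ} (hg : PolyTime I g) :
    PolyTime I fun x => (f x, g x) := by
  have hfsize := hf.polyBounded_size
  have hgsize := hg.polyBounded_size
  obtain ⟨P, T, hT, hP⟩ := hf
  obtain ⟨Q, U, hU, hQ⟩ := hg
  refine ⟨.seq dup (.seq P (.seq swap (.seq Q (.seq swap (.push Stk.main .node))))),
    fun x => (14 * size x + 4) + (T x + ((9 * (size (f x) + size x) + 6) +
      (U x + ((9 * (size (g x) + size (f x)) + 6) + 1)))), by fun_prop, fun x i r => ?_⟩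
  rw [code_pair, List.cons_append, List.append_assoc]
  exact (run_dup_code _).seq ((hP x i _).seq ((run_swap_code _ _).seq ((hQ x i _).seq
    ((run_swap_code _ _).seq run_push_main))))

@[fun_prop]
theorem fst : PolyTime I fun x : α × β => x.1 := by
  refine ⟨.seq (.pop Stk.main) (.seq swap drop), fun x => 1 + ((9 * size x + 6) + (5 * size x + 2)),
    by fun_prop, fun x i r => ?_⟩
  have hsize := size_pair x.1 x.2
  rw [← Prod.mk.eta (p := x), code_pair, List.cons_append, List.append_assoc]
  exact run_pop_main.seq (((run_swap_code _ _).mono (by omega)).seq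
    ((run_drop_code _).mono (by omega)))

@[fun_prop]
theorem snd : PolyTime I fun x : α × β => x.2 := by
  refine ⟨.seq (.pop Stk.main) drop, fun x => 1 + (5 * size x + 2), by fun_prop, fun x i r => ?_⟩
  have hsize := size_pair x.1 x.2
  rw [← Prod.mk.eta (p := x), code_pair, List.cons_append, List.append_assoc]
  exact run_pop_main.seq ((run_drop_code _).mono (by omega))

theorem exists_run_push_polish (t : BinaryTree Unit) : ∃ (P : Prog (Alphabet I)) (n : ℕ),
    ∀ i r, P.Run (work i r) (work i (polish t ++ r)) n := by
  induction t with
  | nil => exact ⟨_, _, fun _ _ => run_push_main⟩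
  | node _ t u iht ihu =>
    obtain ⟨P, m, hP⟩ := iht
    obtain ⟨Q, n, hQ⟩ := ihu
    refine ⟨.seq Q (.seq P (.push Stk.main .node)), n + (m + 1), fun i r => ?_⟩
    rw [polish, List.cons_append, List.append_assoc]
    exact (hQ i r).seq ((hP i _).seq run_push_main)

@[fun_prop]
theorem const (b : β) : PolyTime I fun _ : α => b := by
  obtain ⟨P, n, hP⟩ := exists_run_push_polish (I := I) (toTree b)
  exact ⟨.seq drop P, fun x => 5 * size x + 2 + n, by fun_prop,
    fun x i r => (run_drop_code _).seq (hP i r)⟩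

theorem list_cases {l : α → List β} (hl : PolyTime I l) {f : α → γ} (hf : PolyTime I f)
    {g : α → β → List β → γ} (hg : PolyTime I fun x : α × β × List β => g x.1 x.2.1 x.2.2) :
    PolyTime I fun x => match l x with | [] => f x | b :: m => g x b m := by
  obtain ⟨P, T, hT, hP⟩ := hl.pair .id
  have hsize := hl.polyBounded_size
  obtain ⟨Q, U, hU, hQ⟩ := hf
  obtain ⟨R, V, ⟨p, hp⟩, hR⟩ := hg
  refine ⟨.seq P (.seq (.pop Stk.main) (.ite Stk.main isLeaf (.seq (.pop Stk.main) Q)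
    (.seq swap (.seq (.push Stk.main .node) R)))), fun x => T x + (1 + ((1 + U x) +
      ((9 * (size (l x) + size x) + 6) + (1 + p.eval (size x + size (l x) + 1))) + 1)),
    ?_, fun x i r => (hP x i r).seq ?_⟩
  · have := PolyBounded.eval (T := fun x => size x + size (l x) + 1) (by fun_prop) p
    fun_prop
  · rw [code_pair, List.cons_append, List.append_assoc]
    refine run_pop_main.seq ?_
    beta_reduce
    rcases l x with _ | ⟨b, m⟩
    · refine Run.mono (.ite_true (k := Stk.main) rfl (run_pop_main.seq (hQ x i r))) ?_
      omega
    · have hrun := hR (x, b, m) i r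
      rw [code_pair, List.cons_append, List.append_assoc] at hrun
      have hV : V (x, b, m) ≤ p.eval (size x + size (b :: m) + 1) := size_pair x (b, m) ▸ hp _
      refine Run.mono (.ite_false (k := Stk.main) rfl
        ((run_swap_code (b :: m) x).seq (run_push_main.seq hrun))) ?_
      omega

@[fun_prop]
theorem cons {f : α → β} (hf : PolyTime I f) {l : α → List β} (hl : PolyTime I l) :
    PolyTime I fun x => f x :: l x :=
  (hf.pair hl).of_toTree_eq (fun x => x) (fun _ => rfl) fun _ => rfl

end PolyTime

/-! ### Equality tests -/

namespace Prog

variable {i : List I} {o : List Bool} {m a b c : List Tok}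

/-- Compare the contents of the stack `aux` with the topmost part of the stack `tmp` and remove
both, pushing a symbol to the stack `cnt` for every mismatch. -/
def matchLoop : Prog (Alphabet I) :=
  .loop Stk.aux (fun o => o.isSome) (.seq (.ite Stk.aux isLeaf
      (.ite Stk.tmp isLeaf .skip (.push Stk.cnt Tok.leaf))
      (.ite Stk.tmp isNode .skip (.push Stk.cnt Tok.leaf)))
    (.seq (.pop Stk.aux) (.pop Stk.tmp)))

/-- Push the encoding of a Boolean to the main stack. -/
def pushBool : Bool → Prog (Alphabet I)
  | false => .push Stk.main Tok.leaf
  | true => .seq (.push Stk.main Tok.leaf) (.seq (.push Stk.main Tok.leaf)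
      (.push Stk.main Tok.node))

/-- Push whether the stacks `tmp` and `cnt` are empty. -/
def emptyTest : Prog (Alphabet I) :=
  .ite Stk.tmp (fun o => o.isSome) (pushBool false)
    (.ite Stk.cnt (fun o => o.isSome) (pushBool false) (pushBool true))

/-- Replace the contents of the stacks `aux` and `tmp` by the truth value of their equality. -/
def eqTest : Prog (Alphabet I) :=
  .seq matchLoop (.seq emptyTest (.seq (.loop Stk.tmp (fun o => o.isSome) (.pop Stk.tmp))
    (.loop Stk.cnt (fun o => o.isSome) (.pop Stk.cnt))))

theorem exists_run_match_symbol (s : Tok) (a b c : List Tok) : ∃ c' : List Tok,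
    (c' = [] ↔ c = [] ∧ b.head? = some s) ∧ c'.length ≤ c.length + 1 ∧
      Run (.ite Stk.aux isLeaf (.ite Stk.tmp isLeaf .skip (.push Stk.cnt Tok.leaf))
        (.ite Stk.tmp isNode .skip (.push Stk.cnt Tok.leaf)))
        (st i o m (s :: a) b c) (st i o m (s :: a) b c') 3 := by
  obtain h | h := em (b.head? = some s)
  · refine ⟨c, by simp [h], by omega, ?_⟩
    obtain ⟨b, rfl⟩ := List.head?_eq_some_iff.1 h
    cases s
    · exact .ite_true rfl (.ite_true rfl .skip)
    · exact .ite_false rfl (.ite_true rfl .skip)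
  · refine ⟨.leaf :: c, by simp [h], le_rfl, ?_⟩
    rcases s with _ | _ <;> rcases b with _ | ⟨_ | _, b⟩
    any_goals exact absurd rfl h
    · exact .ite_true rfl (.ite_false rfl run_push_cnt)
    · exact .ite_true rfl (.ite_false rfl run_push_cnt)
    · exact .ite_false rfl (.ite_false rfl run_push_cnt)
    · exact .ite_false rfl (.ite_false rfl run_push_cnt)

theorem exists_run_matchLoop (a b c : List Tok) : ∃ c' : List Tok,
    (c' = [] ↔ c = [] ∧ a <+: b) ∧ c'.length ≤ c.length + a.length ∧
      Run matchLoop (st i o m a b c) (st i o m [] (b.drop a.length) c') (6 * a.length + 1) := by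
  induction a generalizing b c with
  | nil => exact ⟨c, by simp, by simp, .loop_false rfl⟩
  | cons s a ih =>
    obtain ⟨c₁, hc₁, hlen₁, hrun₁⟩ := exists_run_match_symbol (i := i) (o := o) (m := m) s a b c
    obtain ⟨c₂, hc₂, hlen₂, hrun₂⟩ := ih b.tail c₁
    refine ⟨c₂, ?_, by rw [List.length_cons]; omega, ?_⟩
    · rw [hc₂, hc₁, and_assoc]
      cases b <;> simp [List.cons_prefix_cons, eq_comm]
    · have hdrop : b.drop (s :: a).length = b.tail.drop a.length := by
        rw [List.length_cons, Nat.add_comm, ← List.drop_drop, List.drop_one]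
      rw [hdrop]
      refine (Run.loop_true rfl (hrun₁.seq (run_pop_aux.seq run_pop_tmp)) hrun₂).mono ?_
      rw [List.length_cons]
      omega

theorem run_pushBool (x : Bool) :
    Run (pushBool x) (st i o m a b c) (st i o (code x ++ m) a b c) 3 := by
  cases x
  · exact run_push_main.mono (by simp)
  · exact run_push_main.seq (run_push_main.seq run_push_main)

theorem run_emptyTest : Run emptyTest (st i o m a b c)
    (st i o (code (decide (b = [] ∧ c = [])) ++ m) a b c) 5 := by
  rcases b with _ | ⟨s, b⟩
  · rcases c with _ | ⟨s, c⟩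
    · exact .ite_false rfl (.ite_false rfl (run_pushBool true))
    · exact .ite_false rfl (.ite_true rfl (run_pushBool false))
  · rw [decide_eq_false (by simp)]
    exact (Run.ite_true rfl (run_pushBool false)).mono (by omega)

theorem run_clear_tmp : Run (.loop Stk.tmp (fun o => o.isSome) (.pop Stk.tmp)) (st i o m a b c)
    (st i o m a [] c) (2 * b.length + 1) := by
  induction b with
  | nil => exact .loop_false rfl
  | cons s b ih => exact (Run.loop_true rfl run_pop_tmp ih).mono (by rw [List.length_cons]; omega)

theorem run_clear_cnt : Run (.loop Stk.cnt (fun o => o.isSome) (.pop Stk.cnt)) (st i o m a b c)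
    (st i o m a b []) (2 * c.length + 1) := by
  induction c with
  | nil => exact .loop_false rfl
  | cons s c ih => exact (Run.loop_true rfl run_pop_cnt ih).mono (by rw [List.length_cons]; omega)

theorem run_eqTest (a b : List Tok) [Decidable (a = b)] : Run eqTest (st i [] m a b [])
    (work i (code (decide (a = b)) ++ m)) (8 * a.length + 2 * b.length + 8) := by
  obtain ⟨c, hc, hlen, hrun⟩ := exists_run_matchLoop (i := i) (o := []) (m := m) a b []
  have heq : a = b ↔ b.drop a.length = [] ∧ c = [] := by
    rw [hc, eq_self, true_and, List.drop_eq_nil_iff]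
    exact ⟨fun h => ⟨h ▸ le_rfl, h ▸ List.prefix_rfl⟩, fun h => h.2.eq_of_length_le h.1⟩
  simp only [heq]
  refine (hrun.seq (run_emptyTest.seq (run_clear_tmp.seq run_clear_cnt))).mono ?_
  rw [List.length_nil] at hlen
  rw [List.length_drop]
  omega

end Prog

theorem eq_of_polish_append_eq {t u : BinaryTree Unit} : ∀ {r s : List Tok},
    polish t ++ r = polish u ++ s → t = u ∧ r = s := by
  induction t generalizing u with
  | nil => cases u <;> simp [polish]
  | node _ t t' iht iht' =>
    intro r s h
    cases u with
    | nil => simp [polish] at h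
    | node _ u u' =>
      simp only [polish, List.cons_append, List.append_assoc, List.cons.injEq, true_and] at h
      obtain ⟨rfl, htail⟩ := iht h
      obtain ⟨rfl, hrest⟩ := iht' htail
      exact ⟨rfl, hrest⟩

theorem code_injective {α : Type} [TreeEncodable α] : Injective (code : α → List Tok) :=
  fun _ _ h => toTree_injective (eq_of_polish_append_eq (r := []) (s := [])
    (congrArg (· ++ []) h)).1

namespace PolyTime

open Prog

variable {α β γ : Type} [TreeEncodable α] [TreeEncodable β] [TreeEncodable γ]

@[fun_prop]
theorem decide_eq [DecidableEq β] {f g : α → β} (hf : PolyTime I f) (hg : PolyTime I g) :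
    PolyTime I fun x => decide (f x = g x) := by
  classical
  suffices h : PolyTime I fun p : β × β => decide (p.1 = p.2) from h.comp (hf.pair hg)
  refine ⟨.seq (.pop Stk.main) (.seq (scan fun s => .push Stk.aux s)
    (.seq (scan fun s => .push Stk.tmp s) eqTest)), fun p => 1 + ((5 * size p.1 + 2) +
    ((5 * size p.2 + 2) + (8 * size p.1 + 2 * size p.2 + 8))), ?_, fun p i r => ?_⟩
  · have hfst := (fst (I := I) (α := β) (β := β)).polyBounded_size
    have hsnd := (snd (I := I) (α := β) (β := β)).polyBounded_size
    fun_prop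
  · have haux := run_scan (i := i) (r := code p.2 ++ r) id (fun _ => [])
      (fun _ _ _ _ => run_push_aux) (toTree p.1)
    have htmp := run_scan (i := i) (r := r) (fun _ => (code p.1).reverse) id
      (fun _ _ _ _ => run_push_tmp) (toTree p.2)
    have htest := run_eqTest (i := i) (m := r) (code p.1).reverse (code p.2).reverse
    simp only [List.reverse_inj, code_injective.eq_iff, List.length_reverse] at htest
    rw [← Prod.mk.eta (p := p), code_pair, List.cons_append, List.append_assoc]
    exact run_pop_main.seq (haux.seq (htmp.seq htest))

@[fun_prop]
theorem ite {c : α → Prop} [DecidablePred c] (hc : PolyTime I fun x => decide (c x)) {f g : α → β}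
    (hf : PolyTime I f) (hg : PolyTime I g) : PolyTime I fun x => if c x then f x else g x := by
  have hlist : PolyTime I fun x => if c x then [()] else [] :=
    hc.of_toTree_eq (fun x => x) (fun _ => rfl) fun x => by by_cases h : c x <;> simp [h] <;> rfl
  convert hlist.list_cases hg (g := fun x _ _ => f x) (by fun_prop) using 2 with x
  split_ifs <;> rfl

end PolyTime

/-! ### Lists in polynomial time -/

namespace Prog

/-- Fold over the topmost list, where `R` performs a single step. -/
def foldLoop (R : Prog (Alphabet I)) : Prog (Alphabet I) :=
  .loop Stk.main isNode (.seq (.push Stk.main .node) (.seq R (.pop Stk.main)))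

theorem run_foldLoop {α σ : Type} [TreeEncodable α] [TreeEncodable σ] {R : Prog (Alphabet I)}
    {h : σ → α → σ} {p : Polynomial ℕ}
    (hR : ∀ (a : α) (l : List α) (s : σ) i r, Run R (work i (code ((a, l), s) ++ r))
      (work i (code (l, h s a) ++ r)) (p.eval (size ((a, l), s))))
    (i : List I) (r : List Tok) {N M : ℕ} (l : List α) (s : σ)
    (hN : size l + M + 1 ≤ N) (hM : ∀ l', l' <+: l → size (l'.foldl h s) ≤ M) :
    Run (foldLoop R) (work i (code l ++ (code s ++ r)))
      (work i (.leaf :: (code (l.foldl h s) ++ r))) ((p.eval N + 3) * l.length + 1) := by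
  induction l generalizing s with
  | nil => exact .loop_false rfl
  | cons a l ih =>
    have hs : size s ≤ M := hM [] List.nil_prefix
    have hsize : size ((a, l), s) ≤ N := by
      rw [size_cons] at hN
      rw [size_pair, size_pair]
      omega
    have hstep := (hR a l s i r).mono (polynomial_eval_mono p hsize)
    rw [size_cons] at hN
    have hrest := ih (h s a) (by omega) fun l' hl' => hM (a :: l') (by simpa using hl')
    simp only [code_pair, List.cons_append, List.append_assoc] at hstep
    rw [code_cons, List.cons_append, List.append_assoc]
    refine (Run.loop_true rfl (run_push_main.seq (hstep.seq run_pop_main)) hrest).mono ?_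
    rw [List.length_cons, Nat.mul_succ]
    omega

end Prog

namespace PolyTime

open Prog

variable {α β γ σ : Type} [TreeEncodable α] [TreeEncodable β] [TreeEncodable γ] [TreeEncodable σ]

theorem foldl {l : γ → List α} (hl : PolyTime I l) {s : γ → σ} (hs : PolyTime I s)
    {h : γ → σ → α → σ} (hh : PolyTime I fun x : γ × σ × α => h x.1 x.2.1 x.2.2)
    {B : γ → ℕ} (hB : PolyBounded B)
    (hle : ∀ x l', l' <+: l x → size (l'.foldl (h x) (s x)) ≤ B x) :
    PolyTime I fun x => (l x).foldl (h x) (s x) := by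
  let step : γ × σ → α → γ × σ := fun y a => (y.1, h y.1 y.2 a)
  have hstep : PolyTime I fun z : (α × List α) × γ × σ => (z.1.2, step z.2 z.1.1) :=
    .pair (by fun_prop) (.pair (by fun_prop) (hh.comp
      (f := fun z : (α × List α) × γ × σ => (z.2.1, z.2.2, z.1.1)) (by fun_prop)))
  have hfoldl (x : γ) (m : List α) : ∀ s, m.foldl step (x, s) = (x, m.foldl (h x) s) := by
    induction m with
    | nil => exact fun _ => rfl
    | cons a _ ih => exact fun s => ih _
  suffices hfold : PolyTime I fun x => (l x).foldl step (x, s x) by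
    simpa only [hfoldl] using snd.comp hfold
  have hlsize := hl.polyBounded_size
  obtain ⟨R, U, ⟨p, hp⟩, hR⟩ := hstep
  obtain ⟨P, T, hT, hP⟩ := hl.pair (PolyTime.id.pair hs)
  refine ⟨.seq P (.seq (.pop Stk.main) (.seq (foldLoop R) (.pop Stk.main))), fun x => T x + (1 +
    (((p.eval (size (l x) + (size x + B x + 1) + 1) + 3) * size (l x) + 1) + 1)),
    ?_, fun x i r => ?_⟩
  · have := PolyBounded.eval (T := fun x => size (l x) + (size x + B x + 1) + 1) (by fun_prop) p
    fun_prop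
  · have hloop := run_foldLoop (fun a m s i r => (hR ((a, m), s) i r).mono (hp _)) i r (l x)
      (x, s x) le_rfl (M := size x + B x + 1) fun l' hl' => by
        rw [hfoldl, size_pair]
        have := hle x l' hl'
        omega
    have hrun := hP x i r
    rw [code_pair, List.cons_append, List.append_assoc] at hrun
    refine hrun.seq (run_pop_main.seq ((hloop.mono ?_).seq run_pop_main))
    gcongr
    exact (length_lt_size _).le

theorem foldl_of_size_le {l : γ → List α} (hl : PolyTime I l) {s : γ → σ} (hs : PolyTime I s)
    {h : γ → σ → α → σ} (hh : PolyTime I fun x : γ × σ × α => h x.1 x.2.1 x.2.2)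
    {B : γ → ℕ} (hB : PolyBounded B)
    (hle : ∀ x s, ∀ a ∈ l x, size (h x s a) ≤ size s + B x) :
    PolyTime I fun x => (l x).foldl (h x) (s x) := by
  have hlsize := hl.polyBounded_size
  have hssize := hs.polyBounded_size
  refine hl.foldl hs hh (B := fun x => size (s x) + size (l x) * B x) (by fun_prop)
    fun x l' hl' => ?_
  suffices hfold : ∀ (m : List α) s, (∀ a ∈ m, a ∈ l x) →
      size (m.foldl (h x) s) ≤ size s + m.length * B x by
    refine (hfold l' _ fun _ ha => hl'.subset ha).trans ?_
    gcongr
    exact hl'.length_le.trans (length_lt_size _).le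
  intro m
  induction m with
  | nil => simp
  | cons a m ih =>
    intro s hm
    have hrest := ih (h x s a) fun b hb => hm b (.tail _ hb)
    have hhead := hle x s a (hm a (.head _))
    rw [List.foldl_cons, List.length_cons, Nat.succ_mul]
    omega

@[fun_prop]
theorem isEmpty {l : α → List β} (hl : PolyTime I l) : PolyTime I fun x => (l x).isEmpty := by
  convert hl.list_cases (.const true) (g := fun _ _ _ => false) (by fun_prop) using 2
  split <;> simp_all

@[fun_prop]
theorem tail {l : α → List β} (hl : PolyTime I l) : PolyTime I fun x => (l x).tail := by
  convert hl.list_cases (.const []) (g := fun _ _ m => m) (by fun_prop) using 2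
  split <;> simp_all

@[fun_prop]
theorem headD {l : α → List β} (hl : PolyTime I l) {b : α → β} (hb : PolyTime I b) :
    PolyTime I fun x => (l x).headD (b x) := by
  convert hl.list_cases hb (g := fun _ b _ => b) (by fun_prop) using 2
  split <;> simp_all

@[fun_prop]
theorem reverse {l : α → List β} (hl : PolyTime I l) : PolyTime I fun x => (l x).reverse := by
  convert hl.foldl_of_size_le (.const []) (h := fun _ m b => b :: m) (by fun_prop)
    hl.polyBounded_size fun x m b hb => ?_ using 2
  · simp
  · have := size_lt_of_mem hb
    rw [size_cons]
    omega

@[fun_prop]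
theorem append {l m : α → List β} (hl : PolyTime I l) (hm : PolyTime I m) :
    PolyTime I fun x => l x ++ m x := by
  simp only [← List.foldr_cons_eq_append', List.foldr_eq_foldl_reverse]
  exact hl.reverse.foldl_of_size_le hm (h := fun _ m b => b :: m) (by fun_prop)
    hl.polyBounded_size fun x m b hb => by
      have := size_lt_of_mem (List.mem_reverse.1 hb)
      rw [size_cons]
      omega

@[fun_prop]
theorem map {l : α → List β} (hl : PolyTime I l) {f : α → β → γ}
    (hf : PolyTime I fun x : α × β => f x.1 x.2) : PolyTime I fun x => (l x).map (f x) := by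
  obtain ⟨p, hp⟩ := hf.polyBounded_size
  have hlsize := hl.polyBounded_size
  have hbound : PolyBounded fun x => p.eval (size x + size (l x) + 1) :=
    .eval (by fun_prop) p
  simp only [List.map_eq_foldr, List.foldr_eq_foldl_reverse]
  refine hl.reverse.foldl_of_size_le (.const []) (h := fun x m b => f x b :: m)
    (.cons (hf.comp (f := fun y : α × List γ × β => (y.1, y.2.2)) (by fun_prop)) (by fun_prop))
    (hbound.add (.const 1)) fun x m b hb => ?_
  have hfb : size (f x b) ≤ p.eval (size x + size (l x) + 1) :=
    (hp (x, b)).trans (polynomial_eval_mono p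
    (show size (x, b) ≤ size x + size (l x) + 1 by
      have := size_lt_of_mem (List.mem_reverse.1 hb)
      rw [size_pair]
      omega))
  rw [size_cons]
  omega

@[fun_prop]
theorem or {c d : α → Bool} (hc : PolyTime I c) (hd : PolyTime I d) :
    PolyTime I fun x => c x || d x := by
  convert PolyTime.ite (hc.decide_eq (.const true)) (.const true) hd using 2 with x
  cases c x <;> rfl

@[fun_prop]
theorem not {c : α → Bool} (hc : PolyTime I c) : PolyTime I fun x => !c x := by
  convert hc.decide_eq (.const false) using 2 with x
  cases c x <;> rfl

@[fun_prop]
theorem and {c d : α → Bool} (hc : PolyTime I c) (hd : PolyTime I d) :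
    PolyTime I fun x => c x && d x := by
  convert PolyTime.ite (hc.decide_eq (.const true)) hd (.const false) using 2 with x
  cases c x <;> rfl

@[fun_prop]
theorem any {l : α → List β} (hl : PolyTime I l) {c : α → β → Bool}
    (hc : PolyTime I fun x : α × β => c x.1 x.2) : PolyTime I fun x => (l x).any (c x) := by
  have hmap := hl.map hc
  convert hmap.foldl_of_size_le (.const false) (h := fun _ s b => s || b) (by fun_prop)
    (.const 2) _ using 2 with x
  · generalize l x = m
    suffices hfold : ∀ s, (m.map (c x)).foldl (· || ·) s = (s || m.any (c x)) from
      (hfold false).symm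
    induction m with
    | nil => simp
    | cons b m ih => simp [ih, Bool.or_assoc]
  · rintro _ ⟨⟩ ⟨⟩ - <;> decide

@[fun_prop]
theorem all {l : α → List β} (hl : PolyTime I l) {c : α → β → Bool}
    (hc : PolyTime I fun x : α × β => c x.1 x.2) : PolyTime I fun x => (l x).all (c x) := by
  simpa only [List.not_any_eq_all_not, Bool.not_not] using
    (hl.any (c := fun x b => !c x b) hc.not).not

end PolyTime

theorem PolyTime.finite_cases {α β γ : Type} [TreeEncodable α] [TreeEncodable β] [TreeEncodable γ]
    [Finite α] {f : α → β → γ} (hf : ∀ a, PolyTime I (f a)) :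
    PolyTime I fun x : α × β => f x.1 x.2 := by
  classical
  obtain _ | ⟨⟨a₀⟩⟩ := isEmpty_or_nonempty α
  · exact ⟨.skip, _, .const 0, isEmptyElim⟩
  have := Fintype.ofFinite α
  suffices h : ∀ l : List α, ∃ g : α × β → γ, PolyTime I g ∧ ∀ x, x.1 ∈ l → g x = f x.1 x.2 by
    obtain ⟨g, hg, hgf⟩ := h Finset.univ.toList
    rwa [← show g = _ from funext fun x => hgf x (by simp)]
  intro l
  induction l with
  | nil => exact ⟨fun x => f a₀ x.2, (hf a₀).comp .snd, by simp⟩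
  | cons a l ih =>
    obtain ⟨g, hg, hgf⟩ := ih
    refine ⟨fun x => if x.1 = a then f a x.2 else g x,
      .ite (fst.decide_eq (.const a)) ((hf a).comp .snd) hg, fun x hx => ?_⟩
    beta_reduce
    split_ifs with hxa
    · rw [hxa]
    · exact hgf x ((List.mem_cons.1 hx).resolve_left hxa)

/-! ### From programs to Turing machines -/

namespace Prog

theorem exists_run_cons_input [Finite I] [TreeEncodable I] : ∃ (P : Prog (Alphabet I)) (n : ℕ),
    ∀ (s : I) (l i : List I), P.Run (work (s :: i) (code l)) (work i (code (s :: l))) n := by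
  classical
  have := Fintype.ofFinite I
  suffices h : ∀ L : List I, ∃ (P : Prog (Alphabet I)) (n : ℕ), ∀ s ∈ L, ∀ (l i : List I),
      P.Run (work (s :: i) (code l)) (work i (code (s :: l))) n by
    obtain ⟨P, n, h⟩ := h Finset.univ.toList
    exact ⟨P, n, fun s => h s (by simp)⟩
  intro L
  induction L with
  | nil => exact ⟨.skip, 0, by simp⟩
  | cons t L ih =>
    obtain ⟨P, n, hP⟩ := ih
    obtain ⟨Q, m, hQ⟩ := PolyTime.exists_run_push_polish (I := I) (toTree t)
    let isT : Option I → Bool := fun o => decide (o = some t)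
    refine ⟨.ite Stk.inp isT (.seq (.pop Stk.inp) (.seq Q (.push Stk.main .node))) P,
      1 + (m + 1) + n + 1, fun s hs l i => ?_⟩
    obtain rfl | hst := eq_or_ne s t
    · refine Run.mono (.ite_true (k := Stk.inp) (show isT (some s) = true from decide_eq_true rfl)
        (run_pop_inp.seq ((hQ i _).seq run_push_main))) (by omega)
    · refine Run.mono (.ite_false (k := Stk.inp) (show isT (some s) = false from
        decide_eq_false fun h => hst (Option.some.inj h))
        (hP s ((List.mem_cons.1 hs).resolve_left hst) l i)) (by omega)

theorem run_loadLoop [TreeEncodable I] {P : Prog (Alphabet I)} {n : ℕ}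
    (hP : ∀ (s : I) (l i : List I), P.Run (work (s :: i) (code l)) (work i (code (s :: l))) n)
    (i l : List I) : Run (.loop Stk.inp (fun o => o.isSome) P) (work i (code l))
      (work [] (code (i.reverse ++ l))) ((n + 1) * i.length + 1) := by
  induction i generalizing l with
  | nil => exact .loop_false rfl
  | cons s i ih =>
    rw [List.reverse_cons, List.append_assoc]
    refine (Run.loop_true (k := Stk.inp) rfl (hP s l i) (ih (s :: l))).mono ?_
    rw [List.length_cons, Nat.mul_succ]
    omega

/-- Move a Boolean from the main stack to the output. -/
def outputBool : Prog (Alphabet I) :=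
  .ite Stk.main isLeaf (.seq (.pop Stk.main) (.push Stk.out false))
    (.seq (.pop Stk.main) (.seq (.pop Stk.main) (.seq (.pop Stk.main) (.push Stk.out true))))

theorem run_outputBool (x : Bool) :
    Run outputBool (work ([] : List I) (code x)) (st [] [x] [] [] [] []) 5 := by
  cases x
  · exact Run.mono (.ite_true (k := Stk.main) rfl (run_pop_main.seq run_push_out)) (by omega)
  · exact .ite_false (k := Stk.main) rfl
      (run_pop_main.seq (run_pop_main.seq (run_pop_main.seq run_push_out)))

/-- The input is loaded from its front, so it arrives on the main stack in reverse. -/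
theorem exists_run_decide [Finite I] [TreeEncodable I] {f : List I → Bool} (hf : PolyTime I f) :
    ∃ (P : Prog (Alphabet I)) (p : Polynomial ℕ), ∀ l : List I,
      P.Run (work l []) (st [] [f l.reverse] [] [] [] []) (p.eval l.length) := by
  obtain ⟨P, n, hP⟩ := exists_run_cons_input (I := I)
  obtain ⟨Q, T, ⟨q, hq⟩, hQ⟩ := hf
  obtain ⟨N, hN⟩ := (Set.finite_range (size : I → ℕ)).bddAbove
  refine ⟨.seq (.push Stk.main .leaf) (.seq (.loop Stk.inp (fun o => o.isSome) P)
    (.seq Q outputBool)), 1 + (.C (n + 1) * .X + 1 + (q.comp (.X * .C (N + 1) + 1) + 5)),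
    fun l => ?_⟩
  have hload := run_loadLoop hP l []
  have hrun := hQ l.reverse [] []
  have htime : T l.reverse ≤ q.eval (l.length * (N + 1) + 1) :=
    (hq _).trans (polynomial_eval_mono q (by
      simpa using size_le_of_forall_mem fun s (_ : s ∈ l.reverse) => hN ⟨s, rfl⟩))
  simp only [List.append_nil] at hload hrun
  refine (run_push_main.seq (hload.seq (hrun.seq (run_outputBool _)))).mono ?_
  simpa using htime

end Prog

instance [Fintype I] : Fintype (Alphabet I Stk.inp) := inferInstanceAs (Fintype I)

/-- The Turing machine of a program. -/
def toFinTM2 [Fintype I] (P : Prog (Alphabet I)) : FinTM2 where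
  K := Stk
  k₀ := .inp
  k₁ := .out
  Γ := Alphabet I
  Λ := Option P.Label
  main := some P.entry
  σ := Bool
  initialState := false
  m := P.machine

theorem PolyTime.nonempty_tm2ComputableInPolyTime {α : Type} [Finite I] [TreeEncodable I]
    {f : List I → Bool} (hf : PolyTime I f) (e : α → List I) :
    Nonempty (TM2ComputableInPolyTime e Computability.encodeBool fun a => f (e a).reverse) := by
  obtain ⟨P, p, hP⟩ := Prog.exists_run_decide hf
  have := Fintype.ofFinite I
  have hinit : ∀ l : List I, initList (toFinTM2 P) (l.map (Equiv.refl I).invFun) =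
      ⟨some (some P.entry), false, work l []⟩ := fun l => by
    simp only [initList, toFinTM2]
    congr 1
    funext k
    cases k
    exacts [List.map_id l, rfl, rfl, rfl, rfl, rfl]
  have hhalt : ∀ b : Bool, haltList (toFinTM2 P)
      ((Computability.encodeBool b).map (Equiv.refl Bool).invFun) =
      ⟨none, false, st [] [b] [] [] [] []⟩ := fun b => by
    simp only [haltList, toFinTM2]
    congr 1
    funext k
    cases k <;> rfl
  refine ⟨{ tm := toFinTM2 P
            inputAlphabet := Equiv.refl I
            outputAlphabet := Equiv.refl Bool
            time := p + 1
            outputsFun := fun a => ?_ }⟩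
  rw [TM2OutputsInTime, Option.map_some, hinit, hhalt, Polynomial.eval_add, Polynomial.eval_one]
  exact (hP (e a)).nonempty_machine_evalsToInTime.some

end StackMachine

namespace WSD

open Function StackMachine TreeEncodable

/-! ### Solving equations -/

section Solving

variable {T : Type*} [DecidableEq T]

/-- The result of applying the replacements `e.1 ↦ e.2`, `e ∈ θ`, to `t` one after the other; the
lists `θ` serve as substitutions. -/
def subst (θ : List (T × T)) (t : T) : T :=
  θ.foldl (fun t e => if t = e.1 then e.2 else t) t

/-- The replacement that makes `a` and `b` equal. Elements satisfying `c` are the constants, and a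
constant is replaced only if the other side is a constant, too. -/
def orient (c : T → Bool) (a b : T) : T × T := if c a = true then (b, a) else (a, b)

/-- Extend a substitution so that it solves the equation `e`, too. -/
def solveStep (c : T → Bool) (θ : List (T × T)) (e : T × T) : List (T × T) :=
  θ ++ [orient c (subst θ e.1) (subst θ e.2)]

/-- The substitution found by solving the equations `E` from left to right, where the elements
satisfying `c` are the constants. -/
def solve (c : T → Bool) (E : List (T × T)) : List (T × T) := E.foldl (solveStep c) []

/-- The test whether solving `eqs` identifies two different constants or the two sides of one of
the inequations `neqs`. -/
def inconsistent (c : T → Bool) (eqs neqs : List (T × T)) : Bool :=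
  (solve c eqs).any (fun e => c e.1 && !decide (e.1 = e.2)) ||
    neqs.any fun e => decide (subst (solve c eqs) e.1 = subst (solve c eqs) e.2)

theorem solve_append_singleton (c : T → Bool) (E : List (T × T)) (e : T × T) :
    solve c (E ++ [e]) =
      solve c E ++ [orient c (subst (solve c E) e.1) (subst (solve c E) e.2)] := by
  rw [solve, List.foldl_append]
  rfl

theorem subst_append (θ η : List (T × T)) (t : T) : subst (θ ++ η) t = subst η (subst θ t) :=
  List.foldl_append

theorem subst_induction {P : T → Prop} {θ : List (T × T)} (hθ : ∀ e ∈ θ, P e.2) {t : T}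
    (ht : P t) : P (subst θ t) := by
  refine List.foldlRecOn θ _ ht fun t ht e he => ?_
  split_ifs
  · exact hθ e he
  · exact ht

theorem solve_induction {c : T → Bool} {P : T → Prop} {E : List (T × T)}
    (hE : ∀ e ∈ E, P e.1 ∧ P e.2) : ∀ e ∈ solve c E, P e.1 ∧ P e.2 := by
  induction E using List.reverseRecOn with
  | nil => exact fun _ he => absurd he List.not_mem_nil
  | append_singleton E e ih =>
    simp only [List.forall_mem_append, List.forall_mem_singleton] at hE
    have hsub := ih hE.1
    have hP {t : T} (ht : P t) := subst_induction (fun e he => (hsub e he).2) ht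
    simp only [solve_append_singleton, List.forall_mem_append, List.forall_mem_singleton, orient]
    refine ⟨hsub, ?_⟩
    split_ifs
    · exact ⟨hP hE.2.2, hP hE.2.1⟩
    · exact ⟨hP hE.2.1, hP hE.2.2⟩

theorem subst_solve_eq (c : T → Bool) {E : List (T × T)} {e : T × T} (he : e ∈ E) :
    subst (solve c E) e.1 = subst (solve c E) e.2 := by
  induction E using List.reverseRecOn with
  | nil => exact absurd he List.not_mem_nil
  | append_singleton E e' ih =>
    rw [solve_append_singleton, subst_append, subst_append]
    rcases List.mem_append.1 he with he | he
    · rw [ih he]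
    · rw [List.mem_singleton.1 he]
      simp only [subst, orient, List.foldl_cons, List.foldl_nil]
      split_ifs <;> simp_all

theorem const_snd_of_mem_solve {c : T → Bool} {E : List (T × T)} {e : T × T}
    (he : e ∈ solve c E) (hc : c e.1 = true) : c e.2 = true := by
  induction E using List.reverseRecOn with
  | nil => exact absurd he List.not_mem_nil
  | append_singleton E e' ih =>
    rw [solve_append_singleton] at he
    rcases List.mem_append.1 he with he | he
    · exact ih he
    · rw [List.mem_singleton.1 he] at hc ⊢
      unfold orient at hc ⊢
      split_ifs at hc ⊢ <;> simp_all

theorem subst_of_const {c : T → Bool} {θ : List (T × T)} (hθ : ∀ e ∈ θ, c e.1 = true → e.1 = e.2)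
    {t : T} (ht : c t = true) : subst θ t = t :=
  List.foldlRecOn (motive := (· = t)) θ _ rfl fun u hu e he => by
    split_ifs with hue
    · rw [← hθ e he (hue ▸ hu ▸ ht), ← hue, hu]
    · exact hu

theorem inconsistent_eq_false_iff {c : T → Bool} {eqs neqs : List (T × T)} :
    inconsistent c eqs neqs = false ↔ (∀ e ∈ solve c eqs, c e.1 = true → e.1 = e.2) ∧
      ∀ e ∈ neqs, subst (solve c eqs) e.1 ≠ subst (solve c eqs) e.2 := by
  simp [inconsistent]

section Valuation

variable {V : Type*} {v : T → V}

theorem apply_subst {θ : List (T × T)} (hθ : ∀ e ∈ θ, v e.1 = v e.2) (t : T) :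
    v (subst θ t) = v t :=
  List.foldlRecOn (motive := (v · = v t)) θ _ rfl fun u hu e he => by
    split_ifs with hue
    · rw [← hθ e he, ← hue, hu]
    · exact hu

theorem apply_eq_of_mem_solve (c : T → Bool) {E : List (T × T)} (hE : ∀ e ∈ E, v e.1 = v e.2) :
    ∀ e ∈ solve c E, v e.1 = v e.2 := by
  induction E using List.reverseRecOn with
  | nil => exact fun _ he => absurd he List.not_mem_nil
  | append_singleton E e ih =>
    simp only [List.forall_mem_append, List.forall_mem_singleton] at hE
    have hv := ih hE.1
    simp only [solve_append_singleton, List.forall_mem_append, List.forall_mem_singleton, orient]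
    refine ⟨hv, ?_⟩
    split_ifs <;> simp only [apply_subst hv, hE.2]

theorem inconsistent_eq_false {c : T → Bool} (hv : Set.InjOn v {t | c t = true})
    {eqs neqs : List (T × T)} (heqs : ∀ e ∈ eqs, v e.1 = v e.2)
    (hneqs : ∀ e ∈ neqs, v e.1 ≠ v e.2) : inconsistent c eqs neqs = false := by
  have hsolve := apply_eq_of_mem_solve c heqs
  refine inconsistent_eq_false_iff.2 ⟨fun e he hc => hv hc (const_snd_of_mem_solve he hc)
    (hsolve e he), fun e he h => hneqs e he ?_⟩
  rw [← apply_subst hsolve, h, apply_subst hsolve]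

end Valuation

section Map

variable {U : Type*} [DecidableEq U] {g : T → U}

theorem subst_map (hg : Injective g) (θ : List (T × T)) (t : T) :
    subst (θ.map (Prod.map g g)) (g t) = g (subst θ t) := by
  rw [subst, List.foldl_map]
  refine List.foldl_hom g fun t e => ?_
  simp only [Prod.map_fst, Prod.map_snd, hg.eq_iff, apply_ite g]

theorem solve_map (hg : Injective g) {c : T → Bool} {c' : U → Bool} (hc : ∀ t, c' (g t) = c t)
    (E : List (T × T)) : solve c' (E.map (Prod.map g g)) = (solve c E).map (Prod.map g g) := by
  rw [solve, List.foldl_map]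
  refine List.foldl_hom (List.map (Prod.map g g)) (init := []) fun θ e => ?_
  simp only [solveStep, orient, Prod.map_fst, Prod.map_snd, subst_map hg, hc, List.map_append,
    List.map_cons, List.map_nil]
  split_ifs <;> rfl

theorem inconsistent_map (hg : Injective g) {c : T → Bool} {c' : U → Bool}
    (hc : ∀ t, c' (g t) = c t) (eqs neqs : List (T × T)) :
    inconsistent c' (eqs.map (Prod.map g g)) (neqs.map (Prod.map g g)) =
      inconsistent c eqs neqs := by
  simp only [inconsistent, solve_map hg hc, List.any_map, comp_def, Prod.map_fst, Prod.map_snd, hc,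
    subst_map hg, hg.eq_iff]

end Map

theorem length_solve (c : T → Bool) (E : List (T × T)) : (solve c E).length = E.length := by
  induction E using List.reverseRecOn with
  | nil => rfl
  | append_singleton E e ih => simp [solve_append_singleton, ih]

end Solving

section PolyTime

variable {I α T : Type} [DecidableEq T] [TreeEncodable T] [TreeEncodable α]

@[fun_prop]
theorem polyTime_subst {θ : α → List (T × T)} {t : α → T} (hθ : PolyTime I θ)
    (ht : PolyTime I t) : PolyTime I fun x => subst (θ x) (t x) := by
  refine hθ.foldl_of_size_le ht (h := fun _ t e => if t = e.1 then e.2 else t) (by fun_prop)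
    hθ.polyBounded_size fun x t e he => ?_
  have : size (e.1, e.2) < size (θ x) := size_lt_of_mem he
  rw [size_pair] at this
  split_ifs <;> omega

@[fun_prop]
theorem polyTime_solve {c : T → Bool} (hc : PolyTime I c) {E : α → List (T × T)}
    (hE : PolyTime I E) : PolyTime I fun x => solve c (E x) := by
  have hsize := hE.polyBounded_size
  have hstep : PolyTime I fun x : α × List (T × T) × T × T => solveStep c x.2.1 x.2.2 := by
    unfold solveStep orient
    fun_prop
  refine hE.foldl (.const []) (h := fun _ => solveStep c) hstep
    (B := fun x => size (E x) * (2 * size (E x) + 1 + 1) + 1) (by fun_prop) fun x l hl => ?_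
  have hentry : ∀ e ∈ l, size e.1 ≤ size (E x) ∧ size e.2 ≤ size (E x) := fun e he => by
    have : size (e.1, e.2) < size (E x) := size_lt_of_mem (hl.subset he)
    rw [size_pair] at this
    omega
  have hsolve : ∀ e ∈ solve c l, size e ≤ 2 * size (E x) + 1 := fun e he => by
    have := solve_induction (P := fun t => size t ≤ size (E x)) hentry e he
    have hpair : size e = size e.1 + size e.2 + 1 := size_pair e.1 e.2
    omega
  refine (size_le_of_forall_mem hsolve).trans ?_
  rw [length_solve]
  gcongr
  exact hl.length_le.trans (length_lt_size (E x)).le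

@[fun_prop]
theorem polyTime_inconsistent {c : T → Bool} (hc : PolyTime I c) {eqs neqs : α → List (T × T)}
    (heqs : PolyTime I eqs) (hneqs : PolyTime I neqs) :
    PolyTime I fun x => inconsistent c (eqs x) (neqs x) := by
  unfold inconsistent
  fun_prop

end PolyTime

/-! ### The decision procedure -/

/-- A tuple as seen by the decision procedure: the name of its relation and the list of its
entries. -/
abbrev Key (R T : Type) : Type := R × List T

section Certain

variable {R T : Type} [DecidableEq T]

/-- The tuple obtained by substitution in the entries. -/
def substKey (θ : List (T × T)) (k : Key R T) : Key R T := (k.1, k.2.map (subst θ))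

theorem substKey_map {Q U : Type} [DecidableEq U] {g : T → U} (h : R → Q) (hg : Injective g)
    (θ : List (T × T)) (k : Key R T) :
    substKey (θ.map (Prod.map g g)) (Prod.map h (List.map g) k) =
      Prod.map h (List.map g) (substKey θ k) := by
  simp only [substKey, Prod.map_apply', List.map_map, comp_def, subst_map hg]

variable [DecidableEq R]

/-- The test whether every tuple in every row of every component that has no entry `bot` becomes
one of the facts. -/
def coversTuples (bot : T) (θ : List (T × T)) (comps : List (List (List (Key R T))))
    (facts : List (Key R T)) : Bool :=
  comps.all fun C => C.all fun r => r.all fun k =>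
    k.2.any (fun t => decide (t = bot)) || facts.any fun f => decide (f = substKey θ k)

/-- The test whether every fact has a component each of whose rows contains a tuple that becomes
this fact. -/
def coversFacts (θ : List (T × T)) (comps : List (List (List (Key R T))))
    (facts : List (Key R T)) : Bool :=
  facts.all fun f => comps.any fun C => C.all fun r => r.any fun k => decide (f = substKey θ k)

/-- The decision procedure for instance certainty. The constants are the elements satisfying `c`,
and `bot` marks missing tuples; `eqs` and `neqs` are the equations and inequations of the global
condition; a component is the list of its rows, and a row is the list of its tuples. -/
def certain (c : T → Bool) (bot : T) (eqs neqs : List (T × T))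
    (comps : List (List (List (Key R T)))) (facts : List (Key R T)) : Bool :=
  (comps.any fun C => C.isEmpty) || inconsistent c eqs neqs ||
    (coversTuples bot (solve c eqs) comps facts && coversFacts (solve c eqs) comps facts)

theorem certain_map {Q U : Type} [DecidableEq Q] [DecidableEq U] {h : R → Q} {g : T → U}
    (hh : Injective h) (hg : Injective g) {c : T → Bool} {c' : U → Bool}
    (hc : ∀ t, c' (g t) = c t) (bot : T) (eqs neqs : List (T × T))
    (comps : List (List (List (Key R T)))) (facts : List (Key R T)) :
    certain c' (g bot) (eqs.map (Prod.map g g)) (neqs.map (Prod.map g g))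
      (comps.map (List.map (List.map (Prod.map h (List.map g)))))
      (facts.map (Prod.map h (List.map g))) = certain c bot eqs neqs comps facts := by
  have hkey : Injective (Prod.map h (List.map g)) := hh.prodMap (List.map_injective_iff.2 hg)
  simp only [certain, coversTuples, coversFacts, inconsistent_map hg hc, solve_map hg hc,
    List.any_map, List.all_map, comp_def, substKey_map h hg, hkey.eq_iff, Prod.map_snd, hg.eq_iff,
    List.isEmpty_map]

variable {I α : Type} [TreeEncodable R] [TreeEncodable T] [TreeEncodable α]

@[fun_prop]
theorem polyTime_certain {c : T → Bool} (hc : PolyTime I c) (bot : T)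
    {eqs neqs : α → List (T × T)} {comps : α → List (List (List (Key R T)))}
    {facts : α → List (Key R T)} (heqs : PolyTime I eqs) (hneqs : PolyTime I neqs)
    (hcomps : PolyTime I comps) (hfacts : PolyTime I facts) :
    PolyTime I fun x => certain c bot (eqs x) (neqs x) (comps x) (facts x) := by
  unfold certain coversTuples coversFacts substKey
  fun_prop

end Certain

/-! ### Satisfactions of a condition -/

section Condition

variable {D X : Type}

/-- The equations of a condition, between fields so that tuples can be substituted into. -/
def Condition.eqs (φ : Condition D X) : List (Field D X × Field D X) :=
  (φ.filter fun l => l.positive).map fun l => (some l.lhs, some l.rhs)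

/-- The inequations of a condition. -/
def Condition.neqs (φ : Condition D X) : List (Field D X × Field D X) :=
  (φ.filter fun l => !l.positive).map fun l => (some l.lhs, some l.rhs)

/-- The fields whose value does not depend on the valuation; these include `⊥`. -/
def isConstField : Field D X → Bool
  | some (.var _) => false
  | _ => true

/-- The value of a field, where `⊥` has the value `none`. -/
def evalField (ν : X → D) : Field D X → Option D := Option.map (Term.eval ν)

theorem injOn_evalField_isConstField (ν : X → D) :
    Set.InjOn (evalField ν) {t | isConstField t = true} := by
  rintro (_ | _ | _) ht (_ | _ | _) hu h <;> simp_all [evalField, Term.eval, isConstField]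

theorem Condition.holds_iff {φ : Condition D X} {ν : X → D} : φ.Holds ν ↔
    (∀ e ∈ φ.eqs, evalField ν e.1 = evalField ν e.2) ∧
      ∀ e ∈ φ.neqs, evalField ν e.1 ≠ evalField ν e.2 := by
  simp only [eqs, neqs, evalField, List.forall_mem_map, List.mem_filter, Option.map_some,
    ne_eq, Option.some.injEq, and_imp, ← forall₂_and]
  refine forall₂_congr fun l _ => ?_
  cases hl : l.positive <;> simp [Literal.Holds, hl]

theorem exists_injOn_evalField [Infinite D] [Countable X] {F : Set (Field D X)} (hF : F.Finite) :
    ∃ h : X → D, Set.InjOn (evalField h) F := by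
  have hconst : {d : D | some (Term.const d) ∈ F}.Finite :=
    hF.preimage ((Option.some_injective _).comp fun _ _ => Term.const.inj).injOn
  have : Infinite {d : D // d ∉ {d | some (Term.const d) ∈ F}} :=
    hconst.infinite_compl.to_subtype
  obtain ⟨n, hn⟩ := exists_injective_nat X
  let g : ℕ ↪ {d : D // d ∉ {d | some (Term.const d) ∈ F}} := Infinite.natEmbedding _
  refine ⟨fun x => g (n x), ?_⟩
  have hg (x : X) {d : D} (hd : some (.const d) ∈ F) : (g (n x) : D) ≠ d :=
    fun h => (g (n x)).2 (h ▸ hd)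
  rintro (_ | d | x) ht (_ | d' | y) hu h <;>
    simp only [evalField, Option.map_some, Option.map_none, Option.some.injEq, Term.eval,
      reduceCtorEq] at h
  · rfl
  · rw [h]
  · exact absurd h.symm (hg y ht)
  · exact absurd h (hg x hu)
  · rw [hn (g.injective (Subtype.ext h))]

variable [DecidableEq (Field D X)]

/-- The substitution that solves the equations of a condition. -/
def Condition.solution (φ : Condition D X) : List (Field D X × Field D X) :=
  solve isConstField φ.eqs

/-- The test whether a condition has no satisfaction. -/
def Condition.inconsistent (φ : Condition D X) : Bool :=
  WSD.inconsistent isConstField φ.eqs φ.neqs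

namespace Condition

variable {φ : Condition D X} {ν : X → D}

theorem Holds.inconsistent_eq_false (h : φ.Holds ν) : φ.inconsistent = false :=
  WSD.inconsistent_eq_false (injOn_evalField_isConstField ν) (holds_iff.1 h).1 (holds_iff.1 h).2

theorem Holds.evalField_subst (h : φ.Holds ν) (t : Field D X) :
    evalField ν (subst φ.solution t) = evalField ν t :=
  apply_subst (apply_eq_of_mem_solve _ (holds_iff.1 h).1) t

theorem subst_solution_ne_none (φ : Condition D X) {t : Field D X} (ht : t ≠ none) :
    subst φ.solution t ≠ none := by
  refine subst_induction (P := (· ≠ none)) (fun e he => ?_) ht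
  refine (solve_induction (c := isConstField) (P := (· ≠ none)) (fun e he => ?_) e he).2
  obtain ⟨l, -, rfl⟩ := List.mem_map.1 he
  exact ⟨nofun, nofun⟩

theorem subst_solution_of_isConstField (hφ : φ.inconsistent = false) {t : Field D X}
    (ht : isConstField t = true) : subst φ.solution t = t :=
  subst_of_const (inconsistent_eq_false_iff.1 hφ).1 ht

theorem exists_evalField_eq_evalField_subst (hφ : φ.inconsistent = false) (h : X → D) :
    ∃ ν : X → D, ∀ t, evalField ν t = evalField h (subst φ.solution t) := by
  have hsome (x : X) : ∃ t, subst φ.solution (some (.var x)) = some t :=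
    Option.ne_none_iff_exists'.1 (φ.subst_solution_ne_none nofun)
  choose s hs using hsome
  refine ⟨fun x => (s x).eval h, ?_⟩
  rintro (_ | d | x)
  · rw [subst_solution_of_isConstField hφ rfl]
    rfl
  · rw [subst_solution_of_isConstField hφ rfl]
    rfl
  · rw [hs]
    rfl

/-- The variables left by the solution receive distinct fresh values. -/
theorem exists_holds_injOn [Infinite D] [Countable X] (hφ : φ.inconsistent = false)
    {F : Set (Field D X)} (hF : F.Finite) : ∃ ν : X → D, φ.Holds ν ∧ ∀ t ∈ F, ∀ u ∈ F,
      evalField ν t = evalField ν u → subst φ.solution t = subst φ.solution u := by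
  let G : Set (Field D X) := F ∪ {t | t ∈ φ.neqs.map Prod.fst ++ φ.neqs.map Prod.snd}
  obtain ⟨h, hinj⟩ := exists_injOn_evalField
    ((hF.union (List.finite_toSet _)).image (subst φ.solution) : (subst φ.solution '' G).Finite)
  obtain ⟨ν, hν⟩ := exists_evalField_eq_evalField_subst hφ h
  have hsubst {t u : Field D X} (ht : t ∈ G) (hu : u ∈ G) (htu : evalField ν t = evalField ν u) :
      subst φ.solution t = subst φ.solution u := by
    rw [hν, hν] at htu
    exact hinj ⟨t, ht, rfl⟩ ⟨u, hu, rfl⟩ htu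
  refine ⟨ν, holds_iff.2 ⟨fun e he => ?_, fun e he heval => ?_⟩,
    fun t ht u hu => hsubst (.inl ht) (.inl hu)⟩
  · rw [hν, hν, solution, subst_solve_eq _ he]
  · refine (inconsistent_eq_false_iff.1 hφ).2 e he (hsubst (.inr ?_) (.inr ?_) heval)
    · exact List.mem_append_left _ (List.mem_map_of_mem he)
    · exact List.mem_append_right _ (List.mem_map_of_mem he)

end Condition

end Condition

/-! ### Possible worlds -/

section Worlds

variable {S : Schema} {D X : Type}

/-- A tuple of fields in the form used by the decision procedure. -/
def tupleKey (R : S.Rel) (t : Tuple S R (Field D X)) : Key S.Rel (Field D X) := (R, List.ofFn t)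

/-- The tuples of a row in the form used by the decision procedure. -/
def rowKeys {L : List (TupleId S)} (w : Row S D X L) : List (Key S.Rel (Field D X)) :=
  L.attach.map fun s => tupleKey s.1.rel (w s)

/-- A fact in the form used by the decision procedure. -/
def factKey (f : (R : S.Rel) × Tuple S R D) : Key S.Rel (Field D X) :=
  tupleKey f.1 fun j => some (.const (f.2 j))

/-- The value of a tuple under a valuation. -/
def evalKey (ν : X → D) (k : Key S.Rel (Field D X)) : Key S.Rel (Option D) :=
  (k.1, k.2.map (evalField ν))

theorem evalKey_tupleKey_eq_iff {ν : X → D} {R : S.Rel} {u : Tuple S R (Field D X)}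
    {t : Tuple S R D} : evalKey ν (tupleKey R u) = evalKey ν (factKey ⟨R, t⟩) ↔
      ∀ j, evalField ν (u j) = some (t j) := by
  simp only [evalKey, tupleKey, factKey, Prod.mk.injEq, true_and, List.map_ofFn,
    List.ofFn_injective.eq_iff, funext_iff]
  rfl

theorem exists_evalKey_eq_factKey (ν : X → D) {R : S.Rel} {u : Tuple S R (Field D X)}
    (hu : none ∉ (tupleKey R u).2) :
    ∃ t : Tuple S R D, evalKey ν (tupleKey R u) = evalKey ν (factKey ⟨R, t⟩) := by
  have hsome (j) : ∃ t, u j = some t := Option.ne_none_iff_exists'.1 fun hj =>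
    hu (List.mem_ofFn.2 ⟨j, hj⟩)
  choose t ht using hsome
  refine ⟨fun j => (t j).eval ν, evalKey_tupleKey_eq_iff.2 fun j => ?_⟩
  rw [ht]
  rfl

theorem none_notMem_of_evalKey_eq_factKey {ν : X → D} {k : Key S.Rel (Field D X)}
    {f : (R : S.Rel) × Tuple S R D} (h : evalKey ν k = evalKey ν (factKey f)) : none ∉ k.2 := by
  intro hk
  have hmem : none ∈ (evalKey ν k).2 := List.mem_map_of_mem (f := evalField ν) hk
  rw [h] at hmem
  simp [evalKey, factKey, tupleKey, evalField] at hmem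

theorem evalKey_factKey_injective (ν : X → D) :
    Injective fun f : (R : S.Rel) × Tuple S R D => evalKey ν (factKey f) := by
  rintro ⟨R, t⟩ ⟨R', t'⟩ h
  obtain rfl : R = R' := congrArg Prod.fst h
  have ht : t = t' := funext fun j => Option.some_injective _ (evalKey_tupleKey_eq_iff.1 h j)
  rw [ht]

theorem mem_apply_uninline_iff {L : List (TupleId S)} {w : Row S D X L} {φ : Condition D X}
    {ν : X → D} {R : S.Rel} {t : Tuple S R D} : t ∈ (uninline w φ).apply ν R ↔
      ∃ k ∈ rowKeys w, evalKey ν k = evalKey ν (factKey ⟨R, t⟩) := by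
  constructor
  · rintro ⟨u, ⟨d, hd, hu⟩, rfl⟩
    refine ⟨_, List.mem_map_of_mem (List.mem_attach _ ⟨⟨R, d⟩, hd⟩),
      evalKey_tupleKey_eq_iff.2 fun j => ?_⟩
    rw [hu]
    rfl
  · rintro ⟨k, hk, heval⟩
    obtain ⟨⟨⟨R', d⟩, hd⟩, -, rfl⟩ := List.mem_map.1 hk
    obtain rfl : R' = R := congrArg Prod.fst heval
    have hu (j) := Option.map_eq_some_iff.1 (evalKey_tupleKey_eq_iff.1 heval j)
    choose u hu huv using hu
    exact ⟨u, ⟨d, hd, hu⟩, funext huv⟩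

theorem instanceCertain_iff_forall_mem_product {p : Input D X} : InstanceCertain p ↔
    ∀ w ∈ p.wsd.product, ∀ ν : X → D, p.wsd.cond.Holds ν → ∀ f,
      f ∈ p.inst ↔ ∃ k ∈ rowKeys w, evalKey ν k = evalKey ν (factKey f) := by
  simp only [InstanceCertain, GWSD.rep, repGTST, GMultitable.rep, Set.mem_iUnion,
    Set.mem_ofPred_eq, forall_exists_index, and_imp, Sigma.forall, ← mem_apply_uninline_iff
    (φ := p.wsd.cond)]
  constructor
  · intro h w hw ν hν R t
    rw [← h _ w hw ν hν rfl]
    rfl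
  · rintro h _ w hw ν hν rfl
    exact funext fun R => Set.ext (h w hw ν hν R)

namespace GWSD

/-- The projection of a row of the product to one of the components. -/
def restrict (W : GWSD S D X) {C : Component S D X} (hC : C ∈ W.comps) (w : Row S D X W.ids) :
    Row S D X C.ids :=
  fun s => w ⟨s.1, List.mem_flatMap.2 ⟨C, hC, s.2⟩⟩

variable {W : GWSD S D X}

theorem mem_rowKeys_iff {w : Row S D X W.ids} {k : Key S.Rel (Field D X)} :
    k ∈ rowKeys w ↔ ∃ (C : Component S D X) (hC : C ∈ W.comps), k ∈ rowKeys (W.restrict hC w) := by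
  simp only [rowKeys, List.mem_map, List.mem_attach, true_and]
  constructor
  · rintro ⟨⟨s, hs⟩, rfl⟩
    obtain ⟨C, hC, hsC⟩ := List.mem_flatMap.1 hs
    exact ⟨C, hC, ⟨s, hsC⟩, rfl⟩
  · rintro ⟨C, hC, s, rfl⟩
    exact ⟨⟨s, _⟩, rfl⟩

theorem eq_of_mem_ids (W : GWSD S D X) {C C' : Component S D X} (hC : C ∈ W.comps)
    (hC' : C' ∈ W.comps) {s : TupleId S} (hs : s ∈ C.ids) (hs' : s ∈ C'.ids) : C = C' := by
  by_contra hne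
  have : Std.Symm (List.Disjoint on Component.ids (S := S) (D := D) (X := X)) :=
    ⟨fun _ _ h => h.symm⟩
  exact (List.nodup_flatMap.1 W.nodup).2.forall hC hC' hne hs hs'

theorem exists_restrict_eq (W : GWSD S D X) (ρ : ∀ C ∈ W.comps, Row S D X C.ids) :
    ∃ w : Row S D X W.ids, ∀ C hC, W.restrict hC w = ρ C hC := by
  choose c hc hsc using fun s : {s : TupleId S // s ∈ W.ids} => List.mem_flatMap.1 s.2
  have hρ {C C'} (hCC' : C = C') (hC : C ∈ W.comps) (hC' : C' ∈ W.comps) (s : TupleId S)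
      (hs : s ∈ C.ids) (hs' : s ∈ C'.ids) : ρ C hC ⟨s, hs⟩ = ρ C' hC' ⟨s, hs'⟩ := by
    subst hCC'
    rfl
  exact ⟨fun s => ρ (c s) (hc s) ⟨s.1, hsc s⟩, fun C hC => funext fun s =>
    hρ (W.eq_of_mem_ids (hc _) hC (hsc _) s.2) (hc _) hC s.1 (hsc _) s.2⟩

theorem exists_mem_product_restrict_eq (W : GWSD S D X) (hW : ∀ C ∈ W.comps, C.rows ≠ [])
    {C : Component S D X} (hC : C ∈ W.comps) {r : Row S D X C.ids} (hr : r ∈ C.rows) :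
    ∃ w ∈ W.product, W.restrict hC w = r := by
  have hrow (C') (hC' : C' ∈ W.comps) : ∃ r' ∈ C'.rows, ∀ h : C' = C, h ▸ r' = r := by
    by_cases h : C' = C
    · subst h
      exact ⟨r, hr, fun _ => rfl⟩
    · obtain ⟨r', hr'⟩ := List.exists_mem_of_ne_nil _ (hW C' hC')
      exact ⟨r', hr', fun h' => absurd h' h⟩
  choose ρ hρ hρC using hrow
  obtain ⟨w, hw⟩ := W.exists_restrict_eq ρ
  refine ⟨w, fun C' hC' => ?_, (hw C hC).trans (hρC C hC rfl)⟩
  change W.restrict hC' w ∈ C'.rows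
  exact hw C' hC' ▸ hρ C' hC'

theorem exists_comp_of_forall_mem_product {P : Key S.Rel (Field D X) → Prop}
    (h : ∀ w ∈ W.product, ∃ k ∈ rowKeys w, P k) :
    ∃ C ∈ W.comps, ∀ w ∈ C.rows, ∃ k ∈ rowKeys w, P k := by
  -- Otherwise every component has a row without such a tuple, and these rows form a product row.
  by_contra! hno
  choose ρ hρ hρP using hno
  obtain ⟨w, hw⟩ := W.exists_restrict_eq ρ
  obtain ⟨k, hk, hkP⟩ := h w fun C hC => show W.restrict hC w ∈ C.rows from hw C hC ▸ hρ C hC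
  obtain ⟨C, hC, hkC⟩ := mem_rowKeys_iff.1 hk
  rw [hw C hC] at hkC
  exact hρP C hC k hkC hkP

end GWSD

/-- The components of a gWSD in the form used by the decision procedure. -/
def GWSD.keys (W : GWSD S D X) : List (List (List (Key S.Rel (Field D X)))) :=
  W.comps.map fun C => C.rows.map rowKeys

end Worlds

/-! ### Correctness of the decision procedure -/

section Correctness

variable {S : Schema} {D X : Type} [DecidableEq (Field D X)]

namespace Condition

variable {φ : Condition D X} {ν : X → D}

theorem Holds.evalKey_substKey (hν : φ.Holds ν) (k : Key S.Rel (Field D X)) :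
    evalKey ν (substKey φ.solution k) = evalKey ν k := by
  simp only [evalKey, substKey, List.map_map, comp_def, hν.evalField_subst]

theorem substKey_solution_factKey (hφ : φ.inconsistent = false)
    (f : (R : S.Rel) × Tuple S R D) :
    substKey φ.solution (factKey f) = (factKey f : Key S.Rel (Field D X)) := by
  simp only [substKey, factKey, tupleKey, List.map_ofFn, comp_def,
    subst_solution_of_isConstField hφ (t := some (.const _)) rfl]

theorem exists_holds_substKey_eq [Infinite D] [Countable X] (hφ : φ.inconsistent = false)
    (K : List (Key S.Rel (Field D X))) : ∃ ν : X → D, φ.Holds ν ∧ ∀ k ∈ K, ∀ l ∈ K,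
      evalKey ν k = evalKey ν l → substKey φ.solution k = substKey φ.solution l := by
  obtain ⟨ν, hν, hinj⟩ := exists_holds_injOn hφ (List.finite_toSet (K.flatMap Prod.snd))
  refine ⟨ν, hν, fun k hk l hl h => Prod.ext (congrArg Prod.fst h :) ?_⟩
  have hlist : k.2.map (evalField ν) = l.2.map (evalField ν) := congrArg Prod.snd h
  have hlen : k.2.length = l.2.length := by simpa using congrArg List.length hlist
  refine List.ext_getElem (by simpa [substKey]) fun i hi hi' => ?_
  have heval := List.getElem_of_eq hlist (i := i) (by simpa [substKey] using hi)
  rw [List.getElem_map, List.getElem_map] at heval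
  simp only [substKey, List.getElem_map]
  exact hinj _ (List.mem_flatMap.2 ⟨k, hk, List.getElem_mem _⟩) _
    (List.mem_flatMap.2 ⟨l, hl, List.getElem_mem _⟩) heval

end Condition

theorem coversTuples_keys_iff {W : GWSD S D X} {J : Instance S D} :
    coversTuples none W.cond.solution W.keys (J.map factKey) = true ↔
      ∀ C ∈ W.comps, ∀ w ∈ C.rows, ∀ k ∈ rowKeys w, none ∉ k.2 →
        ∃ f ∈ J, factKey f = substKey W.cond.solution k := by
  simp [coversTuples, GWSD.keys, or_iff_not_imp_left]

theorem coversFacts_keys_iff {W : GWSD S D X} {J : Instance S D} :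
    coversFacts W.cond.solution W.keys (J.map factKey) = true ↔
      ∀ f ∈ J, ∃ C ∈ W.comps, ∀ w ∈ C.rows, ∃ k ∈ rowKeys w,
        factKey f = substKey W.cond.solution k := by
  simp [coversFacts, GWSD.keys]

/-- The decision procedure, applied to an input that has not been encoded. -/
def Input.certain (p : Input D X) : Bool :=
  WSD.certain isConstField none p.wsd.cond.eqs p.wsd.cond.neqs p.wsd.keys (p.inst.map factKey)

theorem Input.certain_iff {p : Input D X} : p.certain = true ↔
    (∃ C ∈ p.wsd.comps, C.rows = []) ∨ p.wsd.cond.inconsistent = true ∨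
      coversTuples none p.wsd.cond.solution p.wsd.keys (p.inst.map factKey) = true ∧
        coversFacts p.wsd.cond.solution p.wsd.keys (p.inst.map factKey) = true := by
  simp [Input.certain, WSD.certain, GWSD.keys, Condition.inconsistent, Condition.solution, or_assoc]

theorem exists_mem_rowKeys_evalKey_eq_iff {W : GWSD S D X} {J : Instance S D}
    (htuples : coversTuples none W.cond.solution W.keys (J.map factKey) = true)
    (hfacts : coversFacts W.cond.solution W.keys (J.map factKey) = true)
    {w : Row S D X W.ids} (hw : w ∈ W.product) {ν : X → D} (hν : W.cond.Holds ν)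
    (f : (R : S.Rel) × Tuple S R D) :
    (∃ k ∈ rowKeys w, evalKey ν k = evalKey ν (factKey f)) ↔ f ∈ J := by
  constructor
  · rintro ⟨k, hk, hkf⟩
    obtain ⟨C, hC, hkC⟩ := GWSD.mem_rowKeys_iff.1 hk
    obtain ⟨f', hf', hf'k⟩ := coversTuples_keys_iff.1 htuples C hC _ (hw C hC) k hkC
      (none_notMem_of_evalKey_eq_factKey hkf)
    have heval : evalKey ν (factKey f') = evalKey ν (factKey f) := by
      rw [hf'k, hν.evalKey_substKey, hkf]
    rwa [← evalKey_factKey_injective ν heval]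
  · intro hf
    obtain ⟨C, hC, h⟩ := coversFacts_keys_iff.1 hfacts f hf
    obtain ⟨k, hk, hfk⟩ := h _ (hw C hC)
    exact ⟨k, GWSD.mem_rowKeys_iff.2 ⟨C, hC, hk⟩, by rw [hfk, hν.evalKey_substKey]⟩

theorem coversTuples_and_coversFacts_of_generic {W : GWSD S D X} {J : Instance S D}
    (hW : ∀ C ∈ W.comps, C.rows ≠ []) {ν : X → D}
    (hgeneric : ∀ C ∈ W.comps, ∀ w ∈ C.rows, ∀ k ∈ rowKeys w, ∀ f ∈ J,
      evalKey ν k = evalKey ν (factKey f) → factKey f = substKey W.cond.solution k)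
    (hJ : ∀ w ∈ W.product, ∀ f, f ∈ J ↔ ∃ k ∈ rowKeys w, evalKey ν k = evalKey ν (factKey f)) :
    coversTuples none W.cond.solution W.keys (J.map factKey) = true ∧
      coversFacts W.cond.solution W.keys (J.map factKey) = true := by
  refine ⟨coversTuples_keys_iff.2 fun C hC r hr k hk hnone => ?_,
    coversFacts_keys_iff.2 fun f hf => ?_⟩
  · obtain ⟨w, hw, rfl⟩ := W.exists_mem_product_restrict_eq hW hC hr
    obtain ⟨s, -, rfl⟩ := List.mem_map.1 hk
    obtain ⟨t, ht⟩ := exists_evalKey_eq_factKey ν hnone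
    have hf := (hJ w hw _).2 ⟨_, GWSD.mem_rowKeys_iff.2 ⟨C, hC, hk⟩, ht⟩
    exact ⟨_, hf, hgeneric C hC _ hr _ hk _ hf ht⟩
  · obtain ⟨C, hC, h⟩ := GWSD.exists_comp_of_forall_mem_product fun w hw => (hJ w hw f).1 hf
    refine ⟨C, hC, fun w hw => ?_⟩
    obtain ⟨k, hk, hkf⟩ := h w hw
    exact ⟨k, hk, hgeneric C hC w hw k hk f hf hkf⟩

theorem InstanceCertain.certain [Infinite D] [Countable X] {p : Input D X}
    (h : InstanceCertain p) : p.certain = true := by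
  obtain ⟨S, W, J⟩ := p
  rw [Input.certain_iff]
  by_cases hempty : ∃ C ∈ W.comps, C.rows = []
  · exact .inl hempty
  rcases hcons : W.cond.inconsistent with _ | _
  swap
  · exact .inr (.inl rfl)
  push Not at hempty
  obtain ⟨ν, hν, hsubst⟩ := Condition.exists_holds_substKey_eq hcons
    (W.keys.flatten.flatten ++ J.map factKey)
  refine .inr (.inr (coversTuples_and_coversFacts_of_generic hempty
    (fun C hC w hw k hk f hf hkf => ?_) fun w hw =>
      instanceCertain_iff_forall_mem_product.1 h w hw ν hν))
  have hk' : k ∈ W.keys.flatten.flatten := by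
    simp only [GWSD.keys, List.mem_flatten]
    exact ⟨_, ⟨_, List.mem_map_of_mem hC, List.mem_map_of_mem hw⟩, hk⟩
  have hf' : (factKey f : Key S.Rel (Field D X)) ∈ J.map factKey := List.mem_map_of_mem hf
  rw [hsubst k (List.mem_append_left _ hk') _ (List.mem_append_right _ hf') hkf,
    Condition.substKey_solution_factKey hcons]

theorem InstanceCertain.of_certain {p : Input D X} (h : p.certain = true) :
    InstanceCertain p := by
  refine instanceCertain_iff_forall_mem_product.2 fun w hw ν hν f => ?_
  rcases Input.certain_iff.1 h with ⟨C, hC, hrows⟩ | hcons | ⟨htuples, hfacts⟩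
  · have hmem := hw C hC
    rw [hrows] at hmem
    exact absurd hmem List.not_mem_nil
  · simp [hν.inconsistent_eq_false] at hcons
  · exact (exists_mem_rowKeys_evalKey_eq_iff htuples hfacts hw hν f).symm

end Correctness

/-! ### Reading the input -/

noncomputable instance : TreeEncodable Sym where
  toTree s := toTree (List.replicate (Fintype.equivFin Sym s).val ())
  toTree_injective s t h := by
    exact (Fintype.equivFin Sym).injective <| Fin.ext <|
      by simpa using congrArg List.length (toTree_injective h)

/-- A field as seen by the decision procedure: `Sym.const` or `Sym.var` with a bit string, or
`Sym.bot` with the empty bit string. -/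
abbrev Token : Type := Sym × List Bool

/-- A tuple as found in the input. -/
abbrev TokenKey : Type := Key (List Bool) Token

/-- The state of the reader, which processes the input from right to left: the bit strings and
tokens of the current tuple or literal, the tuples of the current row or list of facts, the rows of
the current component, and finally the components, equations, inequations and facts already
completed. -/
structure Reading where
  words : List (List Bool)
  tokens : List Token
  tuples : List TokenKey
  rows : List (List TokenKey)
  comps : List (List (List TokenKey))
  eqs : List (Token × Token)
  neqs : List (Token × Token)
  facts : List TokenKey

namespace Reading

/-- The state of the reader as a tuple, which provides its encoding by a tree. -/
def toProd (p : Reading) : List (List Bool) × List Token × List TokenKey ×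
    List (List TokenKey) × List (List (List TokenKey)) ×
    List (Token × Token) × List (Token × Token) × List TokenKey :=
  (p.words, p.tokens, p.tuples, p.rows, p.comps, p.eqs, p.neqs, p.facts)

noncomputable instance : TreeEncodable Reading where
  toTree p := toTree p.toProd
  toTree_injective p q h := by
    cases p
    cases q
    simpa [toProd] using toTree_injective h

theorem size_mk (w k t r c e n f) : size (mk w k t r c e n f) =
    size w + size k + size t + size r + size c + size e + size n + size f + 7 := by
  change size (w, k, t, r, c, e, n, f) = _
  simp only [size_pair]
  omega

section PolyTime

variable {I α : Type} [TreeEncodable α]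

theorem polyTime_comp_toProd {f : List (List Bool) × List Token × List TokenKey ×
    List (List TokenKey) × List (List (List TokenKey)) ×
    List (Token × Token) × List (Token × Token) × List TokenKey → α}
    (hf : PolyTime I f) : PolyTime I fun p : Reading => f p.toProd :=
  hf.of_toTree_eq toProd (fun _ => rfl) fun _ => rfl

@[fun_prop]
theorem polyTime_words : PolyTime I words :=
  polyTime_comp_toProd (f := fun x => x.1) (by fun_prop)

@[fun_prop]
theorem polyTime_tokens : PolyTime I tokens :=
  polyTime_comp_toProd (f := fun x => x.2.1) (by fun_prop)

@[fun_prop]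
theorem polyTime_tuples : PolyTime I tuples :=
  polyTime_comp_toProd (f := fun x => x.2.2.1) (by fun_prop)

@[fun_prop]
theorem polyTime_rows : PolyTime I rows :=
  polyTime_comp_toProd (f := fun x => x.2.2.2.1) (by fun_prop)

@[fun_prop]
theorem polyTime_comps : PolyTime I comps :=
  polyTime_comp_toProd (f := fun x => x.2.2.2.2.1) (by fun_prop)

@[fun_prop]
theorem polyTime_eqs : PolyTime I eqs :=
  polyTime_comp_toProd (f := fun x => x.2.2.2.2.2.1) (by fun_prop)

@[fun_prop]
theorem polyTime_neqs : PolyTime I neqs :=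
  polyTime_comp_toProd (f := fun x => x.2.2.2.2.2.2.1) (by fun_prop)

@[fun_prop]
theorem polyTime_facts : PolyTime I facts :=
  polyTime_comp_toProd (f := fun x => x.2.2.2.2.2.2.2) (by fun_prop)

@[fun_prop]
theorem polyTime_mk {w : α → List (List Bool)} {k : α → List Token}
    {t : α → List TokenKey} {r : α → List (List TokenKey)}
    {c : α → List (List (List TokenKey))} {e n : α → List (Token × Token)}
    {f : α → List TokenKey} (hw : PolyTime I w) (hk : PolyTime I k)
    (ht : PolyTime I t) (hr : PolyTime I r) (hc : PolyTime I c) (he : PolyTime I e)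
    (hn : PolyTime I n) (hf : PolyTime I f) :
    PolyTime I fun x => mk (w x) (k x) (t x) (r x) (c x) (e x) (n x) (f x) := by
  have hprod : PolyTime I fun x => (w x, k x, t x, r x, c x, e x, n x, f x) := by fun_prop
  exact hprod.of_toTree_eq id (fun _ => rfl) fun _ => rfl

end PolyTime

/-- The effect of the end of a list of tuples, rows, components or literals: the tuples read before
are the facts of the instance. -/
def close (p : Reading) : Reading :=
  { p with words := [], tokens := [], tuples := [], facts := p.tuples ++ p.facts }

/-- One step of the reader. The identifier of a tuple is a number and a relation name, but a fact
has only the latter; so the last bit string before the entries of a tuple is the relation name. -/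
def step (p : Reading) : Sym → Reading
  | .bit b => { p with words := (b :: p.words.headD []) :: p.words.tail }
  | .eow => { p with words := [] :: p.words }
  | .const => { p with words := p.words.tail, tokens := (.const, p.words.headD []) :: p.tokens }
  | .var => { p with words := p.words.tail, tokens := (.var, p.words.headD []) :: p.tokens }
  | .bot => { p with tokens := (.bot, []) :: p.tokens }
  | .eq => { p with
      tokens := []
      eqs := (p.tokens.headD (.bot, []), p.tokens.tail.headD (.bot, [])) :: p.eqs }
  | .ne => { p with
      tokens := []
      neqs := (p.tokens.headD (.bot, []), p.tokens.tail.headD (.bot, [])) :: p.neqs }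
  | .arity => { p with words := [] }
  | .comp => { p with
      words := [], tokens := [], tuples := [], rows := [], comps := p.rows :: p.comps }
  | .row => { p with words := [], tokens := [], tuples := [], rows := p.tuples :: p.rows }
  | .tup => { p with
      words := [], tokens := [], tuples := (p.words.reverse.headD [], p.tokens) :: p.tuples }
  | .lit => p
  | .close => p.close

/-- Read a string from right to left. -/
def read (p : Reading) (l : List Sym) : Reading := l.foldr (fun s p => p.step s) p

/-- The state of the reader before the first step. -/
def init : Reading := ⟨[], [], [], [], [], [], [], []⟩

theorem polyTime_step {I : Type} : PolyTime I fun x : Sym × Reading => x.2.step x.1 := by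
  refine .finite_cases (f := fun s p => step p s) fun s => ?_
  cases s
  all_goals
    unfold step
    try unfold close
    fun_prop

theorem size_step_le (p : Reading) (s : Sym) :
    size (p.step s) ≤ size p + (size s + (2 * size ((.bot, []) : Token) + 10)) := by
  obtain ⟨w, k, t, r, c, e, n, f⟩ := p
  have hw := size_headD_add_size_tail_le w []
  have hw' := size_headD_reverse_le w []
  have hk := size_headD_add_size_tail_le k (.bot, [])
  have hk' := size_headD_add_size_tail_le k.tail (.bot, [])
  have hf := size_append t f
  cases s
  case bit b =>
    have hb : size b ≤ 3 := by cases b <;> decide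
    simp only [step, size_mk, size_cons, size_nil] at *
    omega
  all_goals
    simp only [step, close, size_mk, size_cons, size_nil, size_pair] at *
    omega

@[fun_prop]
theorem polyTime_read {I α : Type} [TreeEncodable α] (p : Reading) {l : α → List Sym}
    (hl : PolyTime I l) : PolyTime I fun x => p.read (l x) := by
  have hsize := hl.polyBounded_size
  simp only [read, List.foldr_eq_foldl_reverse]
  refine hl.reverse.foldl_of_size_le (.const p) (h := fun _ p s => p.step s)
    (polyTime_step.comp (f := fun x : α × Reading × Sym => (x.2.2, x.2.1)) (by fun_prop))
    (B := fun x => size (l x) + (2 * size ((.bot, []) : Token) + 10)) (by fun_prop)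
    fun x p s hs => (size_step_le p s).trans ?_
  have := size_lt_of_mem (List.mem_reverse.1 hs)
  omega

end Reading

section Encodings

variable {D X : Type} (eD : D ↪ List Bool) (eX : X ↪ List Bool) {S : Schema}

/-- A domain value or variable as seen by the reader. -/
def Term.token : Term D X → Token
  | .const d => (.const, eD d)
  | .var x => (.var, eX x)

/-- A field as seen by the reader. -/
def fieldToken : Field D X → Token
  | none => (.bot, [])
  | some t => t.token eD eX

/-- A tuple as seen by the reader. -/
def tokenKey : Key S.Rel (Field D X) → TokenKey :=
  Prod.map (fun R => Computability.encodeNat R) (List.map (fieldToken eD eX))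

theorem fieldToken_injective : Injective (fieldToken eD eX) := by
  rintro (_ | _ | _) (_ | _ | _) h <;> simp_all [fieldToken, Term.token]

namespace Reading

theorem read_append (p : Reading) (l m : List Sym) : p.read (l ++ m) = (p.read m).read l :=
  List.foldr_append

theorem read_cons (p : Reading) (s : Sym) (l : List Sym) : p.read (s :: l) = (p.read l).step s :=
  rfl

theorem read_flatMap {α β : Type} {f : α → List Sym} {b : α → β} {g : List β → Reading}
    (h : ∀ a bs, (g bs).read (f a) = g (b a :: bs)) (bs : List β) :
    ∀ l : List α, (g bs).read (l.flatMap f) = g (l.map b ++ bs)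
  | [] => rfl
  | a :: l => by rw [List.flatMap_cons, read_append, read_flatMap h bs l, h]; rfl

theorem read_encList {α β : Type} {o : Sym} {enc : α → List Sym} {b : α → β}
    {g : List β → Reading} (h : ∀ a bs, (g bs).read (o :: enc a) = g (b a :: bs)) (bs : List β)
    {p : Reading} (hp : p.close = g bs) (l : List α) :
    p.read (encList o enc l) = g (l.map b ++ bs) := by
  rw [encList, read_append, ← read_flatMap h bs l, ← hp]
  rfl

theorem read_encBits (p : Reading) (w : List Bool) :
    p.read (encBits w) = { p with words := w :: p.words } := by
  induction w with
  | nil => rfl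
  | cons b w ih =>
    change (p.read (encBits w)).step (.bit b) = _
    rw [ih]
    rfl

theorem read_encTerm (p : Reading) (t : Term D X) :
    p.read (encTerm eD eX t) = { p with tokens := t.token eD eX :: p.tokens } := by
  cases t <;> rw [encTerm, read_cons, read_encBits] <;> rfl

theorem read_encField (p : Reading) (t : Field D X) :
    p.read (encField eD eX t) = { p with tokens := fieldToken eD eX t :: p.tokens } := by
  cases t with
  | none => rfl
  | some t => exact read_encTerm eD eX p t

theorem read_encTuple {V : Type} {enc : V → List Sym} {token : V → Token}
    (h : ∀ p v, read p (enc v) = { p with tokens := token v :: p.tokens }) (p : Reading) {n : ℕ}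
    (t : Fin n → V) : p.read (encTuple enc t) =
      { p with tokens := (List.ofFn fun j => token (t j)) ++ p.tokens } := by
  rw [← Function.comp_def, ← List.map_ofFn]
  exact read_flatMap (g := fun k => { p with tokens := k }) (fun v k => h _ v) p.tokens _

theorem read_encRow (p : Reading) {L : List (TupleId S)} (w : Row S D X L) :
    p.read (encRow eD eX w) = { p.close with tuples := (rowKeys w).map (tokenKey eD eX) } := by
  rw [encRow, read_append, rowKeys, List.map_map, ← List.append_nil (List.map _ _)]
  refine read_flatMap (g := fun k => { p.close with tuples := k }) (fun s k => ?_) [] _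
  rw [read_cons, read_append, read_encTuple (read_encField eD eX), encId, read_append, encNat,
    encNat, read_encBits, read_encBits]
  simp only [step, close, comp_apply, tokenKey, tupleKey, Prod.map_apply', List.map_ofFn,
    List.append_nil]
  rfl

theorem read_encComponent (p : Reading) (hp : p.rows = []) (C : Component S D X) :
    p.read (.comp :: encComponent eD eX C) =
      { p.close with
        comps := (C.rows.map fun w => (rowKeys w).map (tokenKey eD eX)) :: p.comps } := by
  have hrows : p.read (encList .row (encRow eD eX) C.rows) =
      { p.close with rows := C.rows.map fun w => (rowKeys w).map (tokenKey eD eX) } := by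
    rw [← List.append_nil (List.map _ _)]
    refine read_encList (g := fun r => { p.close with rows := r }) (fun w r => ?_) [] ?_ _
    · rw [read_cons, read_encRow]
      rfl
    · rw [← hp]
      rfl
  have hids (q : Reading) : q.read (encList .tup encId C.ids) = { q.close with
      tuples := C.ids.map (fun s => (Computability.encodeNat s.rel, [])) } := by
    rw [← List.append_nil (List.map _ _)]
    refine read_encList (p := q) (g := fun k => { q.close with tuples := k }) (fun s k => ?_) []
      rfl _
    rw [read_cons, encId, read_append, encNat, encNat, read_encBits, read_encBits]
    rfl
  rw [read_cons, encComponent, read_append, hrows, hids]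
  simp only [close, step, hp, List.nil_append]

theorem read_encLiterals (p : Reading) (φ : Condition D X) :
    p.read (encList .lit (encLiteral eD eX) φ) = { p.close with
      eqs := φ.eqs.map (Prod.map (fieldToken eD eX) (fieldToken eD eX)) ++ p.eqs
      neqs := φ.neqs.map (Prod.map (fieldToken eD eX) (fieldToken eD eX)) ++ p.neqs } := by
  refine (read_encList (p := p) (b := id) (g := fun φ : Condition D X => { p.close with
    eqs := φ.eqs.map (Prod.map (fieldToken eD eX) (fieldToken eD eX)) ++ p.eqs
    neqs := φ.neqs.map (Prod.map (fieldToken eD eX) (fieldToken eD eX)) ++ p.neqs })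
    (fun l φ => ?_) [] rfl φ).trans (by rw [List.map_id, List.append_nil])
  rw [read_cons, encLiteral, read_cons, read_append, read_encTerm, read_encTerm]
  cases hl : l.positive <;> simp [step, hl, Condition.eqs, Condition.neqs, close, fieldToken]

theorem read_encFacts (p : Reading) (J : Instance S D) :
    p.read (encList .tup (encFact eD) J) =
      { p.close with tuples := J.map fun f => tokenKey eD eX (factKey f) } := by
  rw [← List.append_nil (List.map _ _)]
  refine read_encList (p := p) (g := fun k => { p.close with tuples := k }) (fun f k => ?_) []
    rfl _
  have hconst (q : Reading) (d : D) : q.read (.const :: encBits (eD d)) =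
      { q with tokens := (.const, eD d) :: q.tokens } := read_encTerm eD eX q (.const d)
  rw [read_cons, encFact, read_append, read_encTuple hconst, encNat, read_encBits]
  simp only [step, close, tokenKey, factKey, tupleKey, Prod.map_apply', List.map_ofFn,
    List.append_nil]
  rfl

theorem read_encSchema (p : Reading) (S : Schema) : p.read (encSchema S) = p.close := by
  refine read_encList (p := p) (b := id) (g := fun _ => p.close) (fun n _ => ?_) [] rfl _
  rw [read_cons, encNat, read_encBits]
  rfl

theorem read_encInput (p : Input D X) : init.read (encInput eD eX p) = { init with
    comps := p.wsd.keys.map (List.map (List.map (tokenKey eD eX)))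
    eqs := p.wsd.cond.eqs.map (Prod.map (fieldToken eD eX) (fieldToken eD eX))
    neqs := p.wsd.cond.neqs.map (Prod.map (fieldToken eD eX) (fieldToken eD eX))
    facts := (p.inst.map factKey).map (tokenKey eD eX) } := by
  have hcomps (q : Reading) (hq : q.rows = []) (l : List (Component p.schema D X)) :
      q.read (encList .comp (encComponent eD eX) l) =
        { q.close with
          comps := l.map (fun C => C.rows.map fun w => (rowKeys w).map (tokenKey eD eX)) ++
            q.comps } :=
    read_encList (p := q) (g := fun c => { q.close with comps := c })
      (fun C c => read_encComponent eD eX { q.close with comps := c } hq C) q.comps rfl l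
  rw [encInput, read_append, read_append, encGWSD, read_append, read_encFacts eD eX,
    read_encLiterals, hcomps _ (by rfl), read_encSchema]
  simp only [close, init, List.append_nil, List.nil_append, GWSD.keys, List.map_map, comp_def]

end Reading

/-! ### The decision procedure on encoded inputs -/

/-- The test whether a token denotes a domain value or `⊥`. -/
def isConstToken (t : Token) : Bool := !decide (t.1 = .var)

theorem isConstToken_fieldToken (t : Field D X) :
    isConstToken (fieldToken eD eX t) = isConstField t := by
  rcases t with _ | _ | _ <;> rfl

theorem encodeNat_val_injective {n : ℕ} : Injective fun i : Fin n => Computability.encodeNat i :=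
  (LeftInverse.injective Computability.decode_encodeNat).comp Fin.val_injective

/-- The decision procedure, applied to an input that has been read from its encoding. -/
def Reading.certain (p : Reading) : Bool :=
  WSD.certain isConstToken (.bot, []) p.eqs p.neqs p.comps p.facts

@[fun_prop]
theorem Reading.polyTime_certain {I : Type} : PolyTime I Reading.certain := by
  unfold Reading.certain isConstToken
  fun_prop

theorem Reading.certain_read_encInput [DecidableEq (Field D X)] (p : Input D X) :
    (init.read (encInput eD eX p)).certain = p.certain := by
  rw [Reading.certain, read_encInput]
  exact certain_map encodeNat_val_injective (fieldToken_injective eD eX)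
    (isConstToken_fieldToken eD eX) none _ _ _ _

theorem Reading.certain_read_encInput_iff [Infinite D] (p : Input D X) :
    (init.read (encInput eD eX p)).certain = true ↔ InstanceCertain p := by
  classical
  have : Countable X := eX.injective.countable
  rw [certain_read_encInput]
  exact ⟨InstanceCertain.of_certain, InstanceCertain.certain⟩

end Encodings

end WSD

theorem mainTheorem5 {D X : Type} [Infinite D] (eD : D ↪ List Bool) (eX : X ↪ List Bool) :
    WSD.InPTIME (WSD.encInput eD eX) (WSD.InstanceCertain (D := D) (X := X)) := by
  have hpoly : StackMachine.PolyTime WSD.Sym fun l : List WSD.Sym =>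
      (WSD.Reading.init.read l.reverse).certain := by fun_prop
  refine ⟨fun p => (WSD.Reading.init.read (WSD.encInput eD eX p)).certain,
    WSD.Reading.certain_read_encInput_iff eD eX, ?_⟩
  simpa only [List.reverse_reverse] using
    hpoly.nonempty_tm2ComputableInPolyTime (WSD.encInput eD eX)
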